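/- Let $d\ge 1$ and, for $\hbar>0$, let $\widehat H_\hbar=\sum_{j=1}^d\bigl(-\tfrac{\hbar^2}{2}\partial_{x_j}^2+\tfrac{x_j^2}{2}\bigr)$ be the isotropic harmonic oscillator on $L^2(\mathbb R^d)$, with eigenvalues $E_N(\hbar)=\hbar(N+\tfrac d2)$, $N=0,1,2,\dots$. Let $\Pi_{\hbar,E_N(\hbar)}(x,y)=\sum_{|\alpha|=N}\varphi_{\alpha,\hbar}(x)\varphi_{\alpha,\hbar}(y)$ be the Schwartz kernel of the orthogonal projection onto the $N$-th eigenspace, where $\varphi_{\alpha,\hbar}(x)=\prod_{j=1}^d (2^{\alpha_j}\alpha_j!\sqrt{\pi\hbar})^{-1/2}H_{\alpha_j}(x_j/\sqrt\hbar)\,e^{-x_j^2/2\hbar}$ are the $L^2$-normalized product Hermite functions ($H_k$ the physicists' Hermite polynomials). Define its Wigner distribution and the bulk Wigner--Weyl sum by $$W_{\hbar,E_N(\hbar)}(x,\xi)=\int_{\mathbb R^d}\Pi_{\hbar,E_N(\hbar)}\Bigl(x+\frac v2,x-\frac v2\Bigr)e^{-\frac i\hbar v\cdot\xi}\,\frac{dv}{(2\pi\hbar)^d},\qquad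 W_{\hbar,[0,E]}(x,\xi)=\sum_{N:\,E_N(\hbar)\in[0,E]}W_{\hbar,E_N(\hbar)}(x,\xi).$$ Let $H(x,\xi)=\frac{|x|^2+|\xi|^2}{2}$, and let $\mathrm{Ai}(z)=\frac1{2\pi i}\int_L e^{v^3/3-zv}\,dv$ be the Airy function, where $L$ runs from $e^{-i\pi/3}\infty$ to $e^{i\pi/3}\infty$. **Theorem.** For all $\epsilon>0$ and $\delta>0$ there is a constant $C$, depending only on $d$, $\epsilon$ and $\delta$, such that the following holds for all $E\ge\delta$, all $0<\hbar\le 1$ and all $u\in\mathbb R$ with $|u|<\hbar^{-2/3}$. If $(x,\xi)\in\mathbb R^d\times\mathbb R^d$ satisfies $$H(x,\xi)-E=u\Bigl(\frac{\hbar}{2E}\Bigr)^{2/3}\quad\text{and}\quad H(x,\xi)\ge\delta,$$ then $$\left|W_{\hbar,[0,E]}(x,\xi)-(2\pi\hbar)^{-d}\int_0^\infty\mathrm{Ai}\Bigl(\frac uE+\tau\Bigr)d\tau\right|\le(2\pi\hbar)^{-d}\Bigl[C\,\hbar^{1/3-\epsilon}(1+|u|)^{1/2}+C\,|u|^{5/2}\hbar^{2/3-\epsilon}\Bigr].$$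 -/

import Mathlib

noncomputable section

/-- The `L²`-normalized semiclassical Hermite function of one variable,
`φ_k(x) = (2^k k! √(πħ))^{-1/2} H_k(x/√ħ) e^{-x²/(2ħ)}` with `H_k` the physicists' Hermite
polynomial. It is written with Mathlib's (probabilists') `Polynomial.hermite`, using
`H_k(y) = 2^{k/2} He_k(√2 y)`. -/
def hermiteFn (ħ : ℝ) (k : ℕ) (x : ℝ) : ℝ :=
  (Real.sqrt (k.factorial : ℝ))⁻¹ * (Real.pi * ħ) ^ (-(1 / 4 : ℝ)) *
    Polynomial.aeval (Real.sqrt (2 / ħ) * x) (Polynomial.hermite k) *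
      Real.exp (-x ^ 2 / (2 * ħ))

/-- The product Hermite function `φ_α(x) = ∏ⱼ φ_{αⱼ}(xⱼ)` on `ℝᵈ`. For `|α| = N` these form an
orthonormal basis of the `ħ (N + d/2)`-eigenspace in `L²(ℝᵈ)` of the isotropic harmonic oscillator
`∑ⱼ (-(ħ²/2) ∂ⱼ² + xⱼ²/2)`. -/
def hermiteProd (d : ℕ) (ħ : ℝ) (α : Fin d → ℕ) (x : EuclideanSpace ℝ (Fin d)) : ℝ :=
  ∏ j, hermiteFn ħ (α j) (x j)

/-- The eigenvalue `E_N(ħ) = ħ (N + d/2)` of the isotropic harmonic oscillator on `ℝᵈ`. -/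
def oscEnergy (d : ℕ) (ħ : ℝ) (N : ℕ) : ℝ := ħ * ((N : ℝ) + (d : ℝ) / 2)

/-- The Schwartz kernel `∑_{|α| = N} φ_α(x) φ_α(y)` of the orthogonal projection of `L²(ℝᵈ)` onto
the `E_N(ħ)`-eigenspace of the isotropic harmonic oscillator. -/
def projKernel (d : ℕ) (ħ : ℝ) (N : ℕ) (x y : EuclideanSpace ℝ (Fin d)) : ℝ :=
  ∑ α ∈ Finset.piAntidiag (Finset.univ : Finset (Fin d)) N,
    hermiteProd d ħ α x * hermiteProd d ħ α y

/-- The semiclassical Wigner distribution of a kernel `K`,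
`∫ K(x + v/2, x - v/2) e^{-i v·ξ/ħ} dv / (2πħ)^d`. -/
def wigner (d : ℕ) (ħ : ℝ)
    (K : EuclideanSpace ℝ (Fin d) → EuclideanSpace ℝ (Fin d) → ℝ)
    (x ξ : EuclideanSpace ℝ (Fin d)) : ℂ :=
  ((((2 * Real.pi * ħ) ^ d)⁻¹ : ℝ) : ℂ) *
    ∫ v : EuclideanSpace ℝ (Fin d),
      (K (x + (1 / 2 : ℝ) • v) (x - (1 / 2 : ℝ) • v) : ℂ) *
        Complex.exp (-(Complex.I / (ħ : ℂ)) * ((inner ℝ v ξ : ℝ) : ℂ))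

/-- The Wigner distribution `W_{ħ, E_N(ħ)}` of the `N`-th eigenspace projection. -/
def wignerEigen (d : ℕ) (ħ : ℝ) (N : ℕ) (x ξ : EuclideanSpace ℝ (Fin d)) : ℂ :=
  wigner d ħ (projKernel d ħ N) x ξ

/-- The bulk Wigner distribution `W_{ħ, [E₁, E₂]}`: the sum of `W_{ħ, E_N(ħ)}` over all `N` with
`E_N(ħ) ∈ [E₁, E₂]` (a finite sum when `ħ > 0`). -/
def bulkWigner (d : ℕ) (ħ E₁ E₂ : ℝ) (x ξ : EuclideanSpace ℝ (Fin d)) : ℂ :=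
  ∑ᶠ (N : ℕ) (_ : oscEnergy d ħ N ∈ Set.Icc E₁ E₂), wignerEigen d ħ N x ξ

/-- The classical Hamiltonian `H(x, ξ) = (|x|² + |ξ|²)/2`. -/
def hamiltonian {d : ℕ} (x ξ : EuclideanSpace ℝ (Fin d)) : ℝ := (‖x‖ ^ 2 + ‖ξ‖ ^ 2) / 2

/-- The integral of `e^{v³/3 - z v} dv` along the ray from `0` to `e^{iθ} ∞`. -/
def airyRay (θ z : ℝ) : ℂ :=
  ∫ r in Set.Ioi (0 : ℝ),
    Complex.exp (((r : ℂ) * Complex.exp ((θ : ℂ) * Complex.I)) ^ 3 / 3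
        - (z : ℂ) * ((r : ℂ) * Complex.exp ((θ : ℂ) * Complex.I))) *
      Complex.exp ((θ : ℂ) * Complex.I)

/-- The Airy function on the real line, `Ai(z) = (2πi)⁻¹ ∫_L e^{v³/3 - z v} dv`, where `L` is the
contour that comes from `e^{-iπ/3} ∞` to `0` and goes on to `e^{iπ/3} ∞`. On both rays `v³ = -r³`,
so the integrals converge absolutely; the contour integral is real for real `z`. -/
def airyAi (z : ℝ) : ℝ :=
  ((airyRay (Real.pi / 3) z - airyRay (-(Real.pi / 3)) z)
    / (2 * (Real.pi : ℂ) * Complex.I)).re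

end

/-! The sum over eigenspaces is turned into a single contour integral, which is then compared with
an Airy integral over the same vertical line.

Exact formula. Each one-dimensional Wigner function is `2e^{-r}(-1)^k L_k(2r)` with `r = (x² +
ξ²)/ħ` (`integral_hermiteFn_mul`). The Laguerre generating function multiplies over the coordinates,
and summation over `N` multiplies it by `t/(1-t)`. Extracting a coefficient on the circle `t =
e^{-2w}`, `w = c + iθ`, gives (`bulkWigner_eq`) `(2πħ)^d W = (2π)⁻¹ ∫ e^{mw - μ tanh w} / (cosh^d w
· sinh w) dθ` over `|θ| ≤ π/2`, where `μ = 2H/ħ`, `m = 2n + d - 1`, and `n` counts the admissible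
`N`.

Airy model. Put `Λ³ = 2E/ħ` and `s = u/E`. Then `μ = Λ³ + sΛ` and `|m - Λ³| ≤ d`. Since `w - tanh w
≈ w³/3`, the phase is close to `(Λw)³/3 - s(Λw)`, and the amplitude is close to `1/w`. The integral
of `e^{v³/3 - sv}/v` over a vertical line is the primitive of `Ai` (`integral_airyAi`), and `v = Λw`
identifies the two contours.

Error. The height is `c = a/Λ` with `a` of order `1/(1+|u|)`, so that `e^{-sa}` stays bounded while
both integrands decay like a Gaussian of rate comparable to `Λ²a` (`re_oscPhase_le`). For `|θ| ≤ 1`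
Taylor bounds for `tanh` control the phase difference. For larger `θ` the pole of `cosh^{-d}` near
`±π/2` is beaten by the exponential (`norm_le_outer`). The total is `O((1 + Λ⁻¹a⁻²) Λ⁻¹ a^{-1/2})`
(`exists_norm_integral_sub_le`). With `Λ⁻¹ = O(ħ^{1/3})` this is the claimed bound, already without
the loss `ħ^{-ε}`. -/

open Polynomial in
theorem Polynomial.derivative_hermite_succ (n : ℕ) :
    derivative (hermite (n + 1)) = ((n : ℤ[X]) + 1) * hermite n := by
  induction n with
  | zero => simp [hermite_succ]
  | succ n ih =>
    rw [hermite_succ (n + 1), derivative_sub, derivative_mul, ih, hermite_succ n]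
    simp only [derivative_X, derivative_mul, derivative_add, derivative_natCast, derivative_one]
    push_cast
    ring

/-! ### Wigner functions of Hermite functions and the Laguerre generating function. -/

namespace WignerHermite

open Polynomial MeasureTheory

/-- The Hermite polynomial with complex coefficients. -/
noncomputable def hermiteC (n : ℕ) : ℂ[X] := (hermite n).map (Int.castRingHom ℂ)

theorem hermiteC_zero : hermiteC 0 = 1 := by simp [hermiteC]

theorem hermiteC_succ (n : ℕ) : hermiteC (n + 1) = X * hermiteC n - derivative (hermiteC n) := by
  simp [hermiteC, hermite_succ, derivative_map]

theorem derivative_hermiteC (n : ℕ) : derivative (hermiteC n) = (n : ℂ[X]) * hermiteC (n - 1) := by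
  cases n with
  | zero => simp [hermiteC_zero]
  | succ n =>
    rw [hermiteC, derivative_map, derivative_hermite_succ]
    simp [hermiteC]

theorem hermiteC_eval (n : ℕ) (x : ℝ) :
    (hermiteC n).eval (x : ℂ) = ((aeval x (hermite n) : ℝ) : ℂ) := by
  rw [hermiteC, eval_map, aeval_def, ← Complex.ofRealHom_eq_coe, ← Complex.ofRealHom_eq_coe,
    hom_eval₂]
  congr 1

/-- The integral of a polynomial against the modulated Gaussian `e^{-V²/2 - iΞV}`. -/
noncomputable def gaussInt (Ξ : ℝ) (p : ℂ[X]) : ℂ :=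
  ∫ V : ℝ, p.eval (V : ℂ) * Complex.exp (-(V : ℂ) ^ 2 / 2 - Complex.I * Ξ * V)

theorem norm_cexp_gauss (Ξ V : ℝ) :
    ‖Complex.exp (-(V : ℂ) ^ 2 / 2 - Complex.I * Ξ * V)‖ = Real.exp (-(1 / 2) * V ^ 2) := by
  rw [Complex.norm_exp]
  congr 1
  have : (-(V : ℂ) ^ 2 / 2 - Complex.I * Ξ * V) =
    ((-(1 / 2) * V ^ 2 : ℝ) : ℂ) - Complex.I * ((Ξ * V : ℝ) : ℂ) := by push_cast; ring
  rw [this]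
  simp only [Complex.sub_re, Complex.ofReal_re, Complex.re_mul_ofReal, Complex.I_re]
  simp

theorem integrable_eval_mul_gauss (Ξ : ℝ) (p : ℂ[X]) :
    Integrable (fun V : ℝ =>
      p.eval (V : ℂ) * Complex.exp (-(V : ℂ) ^ 2 / 2 - Complex.I * Ξ * V)) := by
  induction p using Polynomial.induction_on' with
  | add p q hp hq => simp only [eval_add, add_mul]; exact hp.add hq
  | monomial n a =>
    have h := (integrable_rpow_mul_exp_neg_mul_sq (b := 1 / 2) (by norm_num) (s := (n : ℝ))
      (by have : (0 : ℝ) ≤ n := n.cast_nonneg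
          linarith)).norm.const_mul ‖a‖
    refine h.mono' (Continuous.aestronglyMeasurable (by fun_prop)) (.of_forall fun V => ?_)
    rw [eval_monomial, norm_mul, norm_cexp_gauss, norm_mul, norm_pow, Complex.norm_real, norm_mul,
      Real.rpow_natCast, norm_pow, Real.norm_of_nonneg (Real.exp_pos _).le, mul_assoc]

theorem gaussInt_add (Ξ : ℝ) (p q : ℂ[X]) :
    gaussInt Ξ (p + q) = gaussInt Ξ p + gaussInt Ξ q := by
  simp only [gaussInt, eval_add, add_mul]
  exact integral_add (integrable_eval_mul_gauss Ξ p) (integrable_eval_mul_gauss Ξ q)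

theorem gaussInt_C_mul (Ξ : ℝ) (a : ℂ) (p : ℂ[X]) :
    gaussInt Ξ (C a * p) = a * gaussInt Ξ p := by
  simp only [gaussInt, eval_mul, eval_C, mul_assoc]
  exact integral_const_mul _ _

/-- Integration by parts: the derivative of `p(V) e^{-V²/2 - iΞV}` has integral zero. -/
theorem gaussInt_X_mul (Ξ : ℝ) (p : ℂ[X]) :
    gaussInt Ξ (X * p) = gaussInt Ξ (derivative p) - Complex.I * Ξ * gaussInt Ξ p := by
  have key : gaussInt Ξ (derivative p + C (-(Complex.I * Ξ)) * p + C (-1) * (X * p)) = 0 := by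
    refine integral_eq_zero_of_hasDerivAt_of_integrable (f := fun V : ℝ =>
      p.eval (V : ℂ) * Complex.exp (-(V : ℂ) ^ 2 / 2 - Complex.I * Ξ * V)) (fun V => ?_)
      (integrable_eval_mul_gauss Ξ _) (integrable_eval_mul_gauss Ξ p)
    have h1 : HasDerivAt (fun z : ℂ =>
        p.eval z * Complex.exp (-z ^ 2 / 2 - Complex.I * Ξ * z))
        (p.derivative.eval (V : ℂ) * Complex.exp (-(V : ℂ) ^ 2 / 2 - Complex.I * Ξ * V) +
          p.eval (V : ℂ) * (Complex.exp (-(V : ℂ) ^ 2 / 2 - Complex.I * Ξ * V) *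
            (-(2 * (V : ℂ)) / 2 - Complex.I * Ξ))) V := by
      refine (p.hasDerivAt _).mul (HasDerivAt.cexp ?_)
      have h2 := ((hasDerivAt_pow 2 (V : ℂ)).neg.div_const 2).sub
        ((hasDerivAt_id (V : ℂ)).const_mul (Complex.I * Ξ))
      exact h2.congr_deriv (by norm_num)
    refine h1.comp_ofReal.congr_deriv ?_
    simp only [eval_add, eval_mul, eval_C, eval_X]
    ring
  rw [gaussInt_add, gaussInt_add, gaussInt_C_mul, gaussInt_C_mul] at key
  linear_combination -key

theorem gaussInt_one (Ξ : ℝ) :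
    gaussInt Ξ 1 = (Real.sqrt (2 * Real.pi) : ℂ) * Complex.exp (-(Ξ : ℂ) ^ 2 / 2) := by
  have h := fourierIntegral_gaussian (b := 1 / 2) (by norm_num) (-(Ξ : ℂ))
  simp only [gaussInt, eval_one, one_mul]
  rw [show (Real.sqrt (2 * Real.pi) : ℂ) = (Real.pi / (1 / 2 : ℂ)) ^ (1 / 2 : ℂ) by
    rw [Real.sqrt_eq_rpow, Complex.ofReal_cpow (by positivity)]
    push_cast
    congr 1
    ring]
  convert h using 2
  · ext V
    rw [← Complex.exp_add]
    ring_nf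
  · ring_nf

/-- The Gaussian pairing of two reflected and shifted Hermite polynomials. -/
noncomputable def hermitePair (X₀ Ξ : ℝ) (j k : ℕ) : ℂ :=
  gaussInt Ξ ((hermiteC j).comp (C (X₀ : ℂ) + X) * (hermiteC k).comp (C (X₀ : ℂ) - X))

/-- In `He_{j+1}(X₀+V) = (X₀+V) He_j - He_j'` the factor `V` is integrated by parts. The derivative
falling on the left factor cancels `-He_j'`; the one falling on the right factor gives the `k - 1`
term. -/
theorem hermitePair_succ_left (X₀ Ξ : ℝ) (j k : ℕ) :
    hermitePair X₀ Ξ (j + 1) k =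
      (X₀ - Complex.I * Ξ) * hermitePair X₀ Ξ j k - k * hermitePair X₀ Ξ j (k - 1) := by
  have h := gaussInt_X_mul Ξ
    ((hermiteC j).comp (C (X₀ : ℂ) + X) * (hermiteC k).comp (C (X₀ : ℂ) - X))
  rw [derivative_mul, derivative_comp, derivative_comp, derivative_hermiteC k] at h
  have e1 : (hermiteC (j + 1)).comp (C (X₀ : ℂ) + X) * (hermiteC k).comp (C (X₀ : ℂ) - X) =
      C (X₀ : ℂ) * ((hermiteC j).comp (C (X₀ : ℂ) + X) * (hermiteC k).comp (C (X₀ : ℂ) - X)) +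
      (X * ((hermiteC j).comp (C (X₀ : ℂ) + X) * (hermiteC k).comp (C (X₀ : ℂ) - X)) +
      C (-1) * ((derivative (hermiteC j)).comp (C (X₀ : ℂ) + X) *
        (hermiteC k).comp (C (X₀ : ℂ) - X))) := by
    rw [hermiteC_succ]
    simp
    ring
  have e2 : derivative (C (X₀ : ℂ) + X) * (derivative (hermiteC j)).comp (C (X₀ : ℂ) + X) *
        (hermiteC k).comp (C (X₀ : ℂ) - X) +
      (hermiteC j).comp (C (X₀ : ℂ) + X) *
        (derivative (C (X₀ : ℂ) - X) * ((k : ℂ[X]) * hermiteC (k - 1)).comp (C (X₀ : ℂ) - X)) =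
      (derivative (hermiteC j)).comp (C (X₀ : ℂ) + X) * (hermiteC k).comp (C (X₀ : ℂ) - X) +
      C (-(k : ℂ)) * ((hermiteC j).comp (C (X₀ : ℂ) + X) *
        (hermiteC (k - 1)).comp (C (X₀ : ℂ) - X)) := by
    simp
    ring
  rw [e2, gaussInt_add, gaussInt_C_mul] at h
  simp only [hermitePair]
  rw [e1, gaussInt_add, gaussInt_add, gaussInt_C_mul, gaussInt_C_mul, h]
  ring

theorem hermitePair_zero_left (X₀ Ξ : ℝ) (k : ℕ) :
    hermitePair X₀ Ξ 0 k = (X₀ + Complex.I * Ξ) ^ k * gaussInt Ξ 1 := by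
  induction k with
  | zero => simp [hermitePair, hermiteC_zero]
  | succ k ih =>
    have h := gaussInt_X_mul Ξ ((hermiteC k).comp (C (X₀ : ℂ) - X))
    have e1 : (hermiteC 0).comp (C (X₀ : ℂ) + X) * (hermiteC (k + 1)).comp (C (X₀ : ℂ) - X) =
        C (X₀ : ℂ) * (hermiteC k).comp (C (X₀ : ℂ) - X) +
        (C (-1) * (X * (hermiteC k).comp (C (X₀ : ℂ) - X)) +
          C (-1) * (derivative (hermiteC k)).comp (C (X₀ : ℂ) - X)) := by
      rw [hermiteC_succ, hermiteC_zero]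
      simp
      ring
    have e2 : derivative ((hermiteC k).comp (C (X₀ : ℂ) - X)) =
        C (-1) * (derivative (hermiteC k)).comp (C (X₀ : ℂ) - X) := by
      rw [derivative_comp]
      simp
    rw [e2, gaussInt_C_mul] at h
    have ih' : gaussInt Ξ ((hermiteC k).comp (C (X₀ : ℂ) - X)) =
        (X₀ + Complex.I * Ξ) ^ k * gaussInt Ξ 1 := by
      rw [← ih, hermitePair, hermiteC_zero]
      simp
    rw [hermitePair, e1, gaussInt_add, gaussInt_add, gaussInt_C_mul, gaussInt_C_mul,
      gaussInt_C_mul, h, ih']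
    ring

/-- The truncated exponent `k - i` is harmless, because `k.descFactorial i` vanishes for `i > k`. -/
theorem hermitePair_eq (X₀ Ξ : ℝ) (j k : ℕ) :
    hermitePair X₀ Ξ j k = gaussInt Ξ 1 * ∑ i ∈ Finset.range (j + 1),
      (-1) ^ i * (j.choose i) * (k.descFactorial i) *
        (X₀ - Complex.I * Ξ) ^ (j - i) * (X₀ + Complex.I * Ξ) ^ (k - i) := by
  induction j generalizing k with
  | zero => simp [hermitePair_zero_left, mul_comm]
  | succ j ih =>
    rw [hermitePair_succ_left, ih, ih]
    set Z : ℂ := X₀ - Complex.I * Ξ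
    set W : ℂ := X₀ + Complex.I * Ξ
    -- The sum is padded by the vanishing term `i = j + 1`. The other sum is shifted by one index
    -- below, so that Pascal's rule merges the two.
    have hZ : Z * ∑ i ∈ Finset.range (j + 1), (-1) ^ i * (j.choose i : ℂ) * (k.descFactorial i) *
        Z ^ (j - i) * W ^ (k - i) = ∑ i ∈ Finset.range (j + 2),
        (-1) ^ i * (j.choose i : ℂ) * (k.descFactorial i) * Z ^ (j + 1 - i) * W ^ (k - i) := by
      rw [Finset.sum_range_succ _ (j + 1), Nat.choose_succ_self, Finset.mul_sum]
      simp only [Nat.cast_zero, mul_zero, zero_mul, add_zero]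
      refine Finset.sum_congr rfl fun i hi => ?_
      rw [Nat.sub_add_comm (Nat.lt_succ_iff.mp (Finset.mem_range.mp hi)), pow_succ]
      ring
    have hk : (k : ℂ) * ∑ i ∈ Finset.range (j + 1),
        (-1) ^ i * (j.choose i : ℂ) * ((k - 1).descFactorial i) * Z ^ (j - i) * W ^ (k - 1 - i) =
        -∑ i ∈ Finset.range (j + 1), (-1) ^ (i + 1) * (j.choose i : ℂ) *
          (k.descFactorial (i + 1)) * Z ^ (j + 1 - (i + 1)) * W ^ (k - (i + 1)) := by
      rw [Finset.mul_sum, ← Finset.sum_neg_distrib]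
      refine Finset.sum_congr rfl fun i _ => ?_
      have : (k.descFactorial (i + 1) : ℂ) = k * ((k - 1).descFactorial i) := by
        cases k with
        | zero => simp
        | succ k => rw [Nat.succ_descFactorial_succ]; push_cast; simp
      rw [this, Nat.add_sub_add_right, Nat.sub_sub, add_comm 1 i]
      ring
    rw [mul_left_comm, mul_left_comm (k : ℂ), ← mul_sub, hZ, hk, sub_neg_eq_add,
      Finset.sum_range_succ' _ (j + 1), Finset.sum_range_succ' _ (j + 1), add_right_comm,
      ← Finset.sum_add_distrib]
    congr 2
    · refine Finset.sum_congr rfl fun i _ => ?_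
      rw [Nat.choose_succ_succ]
      push_cast
      ring
    · simp

/-- The coefficient `(-1)^k L_k(R)`, with `L_k` the Laguerre polynomial. -/
noncomputable def laguerreCoeff (R : ℝ) (k : ℕ) : ℝ :=
  ∑ p ∈ Finset.HasAntidiagonal.antidiagonal k, (R ^ p.1 / p.1.factorial) * ((p.2 + p.1).choose p.1 * (-1) ^ p.2)

theorem hermitePair_self (X₀ Ξ : ℝ) (k : ℕ) :
    hermitePair X₀ Ξ k k / k.factorial = gaussInt Ξ 1 * laguerreCoeff (X₀ ^ 2 + Ξ ^ 2) k := by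
  rw [hermitePair_eq, mul_div_assoc, laguerreCoeff, Finset.Nat.sum_antidiagonal_eq_sum_range_succ_mk,
    ← Finset.sum_range_reflect]
  push_cast
  rw [Finset.sum_div]
  congr 1
  refine Finset.sum_congr rfl fun i hi => ?_
  have hi : i ≤ k := Nat.lt_succ_iff.mp (Finset.mem_range.mp hi)
  have h2 : k - (k - i) = i := by omega
  have h3 : k - i + i = k := by omega
  simp only [h2, h3]
  have hf : (i.factorial : ℂ) * (k.descFactorial (k - i)) = k.factorial := by
    have := Nat.factorial_mul_descFactorial (Nat.sub_le k i)
    rw [h2] at this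
    exact_mod_cast this
  have hR : ((X₀ : ℂ) ^ 2 + (Ξ : ℂ) ^ 2) = (X₀ - Complex.I * Ξ) * (X₀ + Complex.I * Ξ) := by
    linear_combination ((Ξ : ℂ) ^ 2) * Complex.I_sq
  have hk : (k.factorial : ℂ) ≠ 0 := by exact_mod_cast k.factorial_ne_zero
  have hi0 : (i.factorial : ℂ) ≠ 0 := by exact_mod_cast i.factorial_ne_zero
  rw [hR, mul_pow, Nat.choose_symm hi]
  field_simp
  linear_combination (X₀ - Complex.I * Ξ) ^ i * (X₀ + Complex.I * Ξ) ^ i * (k.choose i) * hf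

/-- The double series with terms `(Rt)^m/m! · C(n+m, m) (-t)^n` converges absolutely. Summing over
`n` first gives `(Rt)^m / (m! (1+t)^{m+1})`, hence the exponential; summing along antidiagonals
gives the Laguerre coefficients. -/
theorem hasSum_laguerreCoeff (R : ℝ) {t : ℂ} (ht : ‖t‖ < 1) :
    HasSum (fun k : ℕ => (laguerreCoeff R k : ℂ) * t ^ k)
      ((1 + t)⁻¹ * Complex.exp (R * t / (1 + t))) := by
  obtain ⟨f, hf⟩ : ∃ f : ℕ × ℕ → ℂ, f = fun p =>
    ((R * t) ^ p.1 / p.1.factorial) * ((p.2 + p.1).choose p.1 * (-t) ^ p.2) := ⟨_, rfl⟩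
  have hinner (m : ℕ) : HasSum (fun n => f (m, n))
      (((R * t) ^ m / m.factorial) * (1 / (1 + t) ^ (m + 1))) := by
    have h := hasSum_choose_mul_geometric_of_norm_lt_one m (r := -t) (by simpa using ht)
    rw [sub_neg_eq_add] at h
    have h' := h.mul_left ((R * t : ℂ) ^ m / m.factorial)
    simpa only [hf] using h'
  have hsum : Summable f := by
    rw [← summable_norm_iff, summable_prod_of_nonneg (fun _ => norm_nonneg _)]
    refine ⟨fun m => (hinner m).summable.norm, ?_⟩
    have hin (m : ℕ) : ∑' n, ‖f (m, n)‖ =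
        (1 - ‖t‖)⁻¹ * ((‖(R * t : ℂ)‖ / (1 - ‖t‖)) ^ m / m.factorial) := by
      have h := (hasSum_choose_mul_geometric_of_norm_lt_one m (r := ‖t‖) (by simpa using ht)).mul_left
        (‖(R * t : ℂ)‖ ^ m / m.factorial)
      rw [(h.congr_fun (g := fun n => ‖f (m, n)‖) ?_).tsum_eq, div_pow]
      · have : (1 - ‖t‖) ≠ 0 := by linarith
        field_simp
        ring
      · simp [hf]
    simp only [hin]
    exact (Real.summable_pow_div_factorial _).mul_left _
  have ht1 : 1 + t ≠ 0 := by
    intro h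
    rw [eq_neg_of_add_eq_zero_right h] at ht
    simp at ht
  have h1 : HasSum f ((1 + t)⁻¹ * Complex.exp (R * t / (1 + t))) := by
    have h := hsum.hasSum.prod_fiberwise hinner
    have h2 : HasSum (fun m : ℕ => ((R * t) ^ m / m.factorial) * (1 / (1 + t) ^ (m + 1)))
        ((1 + t)⁻¹ * Complex.exp (R * t / (1 + t))) := by
      have h3 := (NormedSpace.expSeries_div_hasSum_exp (R * t / (1 + t))).mul_left (1 + t)⁻¹
      rw [← Complex.exp_eq_exp_ℂ] at h3
      refine h3.congr_fun fun m => ?_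
      rw [div_pow]
      field_simp
      ring
    rw [h2.unique h]
    exact hsum.hasSum
  rw [← Finset.HasAntidiagonal.sigmaAntidiagonalEquivProd.hasSum_iff] at h1
  refine (h1.sigma (fun k => hasSum_fintype _)).congr_fun fun k => ?_
  simp only [Function.comp, Finset.HasAntidiagonal.sigmaAntidiagonalEquivProd_apply]
  rw [Finset.sum_coe_sort (Finset.HasAntidiagonal.antidiagonal k) (fun p => f p), laguerreCoeff]
  push_cast
  rw [Finset.sum_mul]
  refine Finset.sum_congr rfl fun p hp => ?_
  rw [← Finset.HasAntidiagonal.mem_antidiagonal.mp hp, hf, pow_add]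
  simp only [mul_pow, neg_pow t]
  ring

/-- The scaling `v = √(2ħ) V` makes the Hermite arguments `X₀ ± V` with `X₀ = √(2/ħ) x` and the
weight `e^{-V²/2}`, which is the form of `hermitePair`. -/
theorem hermiteFn_mul_eq {ħ : ℝ} (hħ : 0 < ħ) (k : ℕ) (x ξ V : ℝ) :
    ((hermiteFn ħ k (x + (1 / 2) * (Real.sqrt (2 * ħ) * V)) *
        hermiteFn ħ k (x - (1 / 2) * (Real.sqrt (2 * ħ) * V)) : ℝ) : ℂ) *
      Complex.exp (-(Complex.I / ħ) * ((Real.sqrt (2 * ħ) * V * ξ : ℝ) : ℂ)) =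
    (((k.factorial : ℝ)⁻¹ * (Real.sqrt (Real.pi * ħ))⁻¹ * Real.exp (-(x ^ 2 / ħ)) : ℝ) : ℂ) *
      (((hermiteC k).comp (C ((Real.sqrt (2 / ħ) * x : ℝ) : ℂ) + X) *
          (hermiteC k).comp (C ((Real.sqrt (2 / ħ) * x : ℝ) : ℂ) - X)).eval (V : ℂ) *
        Complex.exp (-(V : ℂ) ^ 2 / 2 - Complex.I * ((Real.sqrt (2 / ħ) * ξ : ℝ) : ℂ) * V)) := by
  set a := Real.sqrt (2 / ħ) with ha
  set b := Real.sqrt (2 * ħ) with hb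
  have hb2 : b ^ 2 = 2 * ħ := Real.sq_sqrt (by positivity)
  have hab : a * b = 2 := by
    rw [ha, hb, ← Real.sqrt_mul (by positivity)]
    rw [show 2 / ħ * (2 * ħ) = 2 ^ 2 by field_simp]
    exact Real.sqrt_sq (by norm_num)
  have hba : b / ħ = a := by
    have : b ≠ 0 := by rw [hb]; positivity
    field_simp
    apply mul_left_cancel₀ this
    linear_combination hb2 - ħ * hab
  have e1 : a * (x + (1 / 2) * (b * V)) = a * x + V := by linear_combination (V / 2) * hab
  have e2 : a * (x - (1 / 2) * (b * V)) = a * x - V := by linear_combination -(V / 2) * hab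
  have e3 : Complex.exp (-(Complex.I / ħ) * ((b * V * ξ : ℝ) : ℂ)) =
      Complex.exp (-(Complex.I * ((a * ξ : ℝ) : ℂ) * V)) := by
    rw [← hba]
    push_cast
    ring_nf
  have e4 : -(x + (1 / 2) * (b * V)) ^ 2 / (2 * ħ) + -(x - (1 / 2) * (b * V)) ^ 2 / (2 * ħ) =
      -(x ^ 2 / ħ) + -V ^ 2 / 2 := by
    field_simp
    linear_combination (-2 * V ^ 2) * hb2
  have e5 : (Real.pi * ħ) ^ (-(1 / 4 : ℝ)) * (Real.pi * ħ) ^ (-(1 / 4 : ℝ)) =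
      (Real.sqrt (Real.pi * ħ))⁻¹ := by
    have : 0 < Real.pi * ħ := by positivity
    rw [← Real.rpow_add this, Real.sqrt_eq_rpow, ← Real.rpow_neg this.le]
    norm_num
  have e6 : (Real.sqrt (k.factorial : ℝ))⁻¹ * (Real.sqrt (k.factorial : ℝ))⁻¹ =
      (k.factorial : ℝ)⁻¹ := by
    rw [← mul_inv, Real.mul_self_sqrt (by positivity)]
  have e7 : hermiteFn ħ k (x + (1 / 2) * (b * V)) * hermiteFn ħ k (x - (1 / 2) * (b * V)) =
      (k.factorial : ℝ)⁻¹ * (Real.sqrt (Real.pi * ħ))⁻¹ * Real.exp (-(x ^ 2 / ħ)) *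
        (aeval (a * x + V) (hermite k) * aeval (a * x - V) (hermite k) *
          Real.exp (-V ^ 2 / 2)) := by
    simp only [hermiteFn, ← ha]
    have e8 := congrArg Real.exp e4
    rw [Real.exp_add, Real.exp_add] at e8
    rw [e1, e2, ← e5, ← e6]
    linear_combination ((Real.sqrt (k.factorial : ℝ))⁻¹ * (Real.sqrt (k.factorial : ℝ))⁻¹ *
      ((Real.pi * ħ) ^ (-(1 / 4 : ℝ)) * (Real.pi * ħ) ^ (-(1 / 4 : ℝ))) *
      (aeval (a * x + V) (hermite k) * aeval (a * x - V) (hermite k))) * e8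
  rw [e3, e7, sub_eq_add_neg (-(V : ℂ) ^ 2 / 2), Complex.exp_add, eval_mul, eval_comp, eval_comp]
  simp only [eval_add, eval_sub, eval_C, eval_X]
  rw [← Complex.ofReal_add, ← Complex.ofReal_sub, hermiteC_eval, hermiteC_eval]
  push_cast
  ring

theorem integrable_hermiteFn_mul {ħ : ℝ} (hħ : 0 < ħ) (k : ℕ) (x ξ : ℝ) :
    Integrable fun v : ℝ =>
      ((hermiteFn ħ k (x + (1 / 2) * v) * hermiteFn ħ k (x - (1 / 2) * v) : ℝ) : ℂ) *
        Complex.exp (-(Complex.I / ħ) * ((v * ξ : ℝ) : ℂ)) := by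
  have hb : Real.sqrt (2 * ħ) ≠ 0 := by positivity
  rw [← integrable_comp_mul_left_iff _ hb]
  simp only [hermiteFn_mul_eq hħ]
  exact (integrable_eval_mul_gauss _ _).const_mul _

/-- The one-dimensional Wigner transform of `φ_k ⊗ φ_k` is a Laguerre function. -/
theorem integral_hermiteFn_mul {ħ : ℝ} (hħ : 0 < ħ) (k : ℕ) (x ξ : ℝ) :
    ∫ v : ℝ, ((hermiteFn ħ k (x + (1 / 2) * v) * hermiteFn ħ k (x - (1 / 2) * v) : ℝ) : ℂ) *
        Complex.exp (-(Complex.I / ħ) * ((v * ξ : ℝ) : ℂ)) =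
      ((2 * Real.exp (-((x ^ 2 + ξ ^ 2) / ħ)) *
        laguerreCoeff (2 * (x ^ 2 + ξ ^ 2) / ħ) k : ℝ) : ℂ) := by
  have hb : 0 < Real.sqrt (2 * ħ) := by positivity
  have h := Measure.integral_comp_mul_left (fun v : ℝ =>
    ((hermiteFn ħ k (x + (1 / 2) * v) * hermiteFn ħ k (x - (1 / 2) * v) : ℝ) : ℂ) *
        Complex.exp (-(Complex.I / ħ) * ((v * ξ : ℝ) : ℂ))) (Real.sqrt (2 * ħ))
  simp only [hermiteFn_mul_eq hħ] at h
  rw [integral_const_mul, abs_of_pos (inv_pos.mpr hb), eq_comm, inv_smul_eq_iff₀ hb.ne'] at h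
  rw [h]
  have h2 := hermitePair_self (Real.sqrt (2 / ħ) * x) (Real.sqrt (2 / ħ) * ξ) k
  rw [gaussInt_one, hermitePair, gaussInt, div_eq_iff (by exact_mod_cast k.factorial_ne_zero)] at h2
  rw [h2, mul_pow, mul_pow, Real.sq_sqrt (by positivity), ← mul_add,
    show 2 / ħ * (x ^ 2 + ξ ^ 2) = 2 * (x ^ 2 + ξ ^ 2) / ħ by ring,
    show Complex.exp (-((Real.sqrt (2 / ħ) * ξ : ℝ) : ℂ) ^ 2 / 2) =
      ((Real.exp (-(ξ ^ 2 / ħ)) : ℝ) : ℂ) by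
        rw [← Complex.ofReal_pow, mul_pow, Real.sq_sqrt (by positivity)]
        push_cast
        congr 1
        field_simp,
    show -((x ^ 2 + ξ ^ 2) / ħ) = -(x ^ 2 / ħ) + -(ξ ^ 2 / ħ) by ring, Real.exp_add,
    Complex.real_smul]
  norm_cast
  have hs : Real.sqrt (2 * ħ) * Real.sqrt (2 * Real.pi) = 2 * Real.sqrt (Real.pi * ħ) := by
    rw [← Real.sqrt_mul (by positivity), show 2 * ħ * (2 * Real.pi) = 2 ^ 2 * (Real.pi * ħ) by ring,
      Real.sqrt_mul (by positivity), Real.sqrt_sq (by norm_num)]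
  have hk : (k.factorial : ℝ) ≠ 0 := by exact_mod_cast k.factorial_ne_zero
  have hp : Real.sqrt (Real.pi * ħ) ≠ 0 := by positivity
  generalize Real.sqrt (Real.pi * ħ) = q at hs hp
  field_simp
  linear_combination laguerreCoeff (2 * (x ^ 2 + ξ ^ 2) / ħ) k * hs

end WignerHermite

/-! ### Products of generating functions and the contour formula for the bulk sum. -/

namespace WignerHermite

open MeasureTheory Finset

theorem sum_finsuppAntidiag_univ {ι M : Type*} [Fintype ι] [DecidableEq ι] [AddCommMonoid M]
    (N : ℕ) (F : (ι → ℕ) → M) :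
    ∑ l ∈ finsuppAntidiag (univ : Finset ι) N, F l = ∑ α ∈ piAntidiag (univ : Finset ι) N, F α := by
  refine sum_nbij (fun l => ⇑l) (fun l hl => ?_) (fun _ _ _ _ h => DFunLike.coe_injective h)
    (fun α hα => ?_) (fun _ _ => rfl)
  · simpa using hl
  · exact ⟨Finsupp.equivFunOnFinite.symm α, by simpa using hα, by simp⟩

theorem hasSum_coeff_mul {φ ψ : PowerSeries ℂ} {t a b : ℂ}
    (hφ : HasSum (fun n => PowerSeries.coeff n φ * t ^ n) a)
    (hψ : HasSum (fun n => PowerSeries.coeff n ψ * t ^ n) b) :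
    HasSum (fun n => PowerSeries.coeff n (φ * ψ) * t ^ n) (a * b) := by
  have h := hasSum_sum_range_mul_of_summable_norm hφ.summable.norm hψ.summable.norm
  rw [hφ.tsum_eq, hψ.tsum_eq] at h
  refine h.congr_fun fun n => ?_
  rw [PowerSeries.coeff_mul, sum_mul, Nat.sum_antidiagonal_eq_sum_range_succ_mk]
  refine sum_congr rfl fun k hk => ?_
  have hk : k + (n - k) = n := by have := mem_range.mp hk; omega
  simp only
  rw [← hk, pow_add, hk]
  ring

theorem hasSum_sum_piAntidiag {ι : Type*} [Fintype ι] [DecidableEq ι] (f : ι → ℕ → ℂ) {t : ℂ}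
    {F : ι → ℂ} (h : ∀ i, HasSum (fun n => f i n * t ^ n) (F i)) :
    HasSum (fun N => (∑ α ∈ piAntidiag (univ : Finset ι) N, ∏ i, f i (α i)) * t ^ N)
      (∏ i, F i) := by
  have key (s : Finset ι) : HasSum
      (fun n => PowerSeries.coeff n (∏ i ∈ s, PowerSeries.mk (f i)) * t ^ n) (∏ i ∈ s, F i) := by
    induction s using Finset.induction_on with
    | empty =>
      simp only [prod_empty, PowerSeries.coeff_one]
      convert hasSum_single (f := fun n : ℕ => (if n = 0 then (1 : ℂ) else 0) * t ^ n) 0 ?_ using 1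
      · simp
      · intro n hn
        simp [hn]
    | insert i s hi ih =>
      rw [prod_insert hi, prod_insert hi]
      exact hasSum_coeff_mul (by simpa using h i) ih
  refine (key univ).congr_fun fun N => ?_
  rw [PowerSeries.coeff_prod]
  simp only [PowerSeries.coeff_mk]
  rw [sum_finsuppAntidiag_univ N (fun l => ∏ i, f i (l i))]

/-- Cauchy product with the geometric series. The partial sums stop strictly below `n`, hence
`t/(1-t)` and not `1/(1-t)`. -/
theorem hasSum_sum_range {f : ℕ → ℂ} {t F : ℂ} (ht : ‖t‖ < 1)
    (h : HasSum (fun n => f n * t ^ n) F) :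
    HasSum (fun n => (∑ k ∈ range n, f k) * t ^ n) (t / (1 - t) * F) := by
  have h1 := hasSum_sum_range_mul_of_summable_norm h.summable.norm
    (summable_norm_geometric_of_norm_lt_one ht)
  rw [h.tsum_eq, tsum_geometric_of_norm_lt_one ht] at h1
  rw [← hasSum_nat_add_iff' 1]
  have h2 := h1.mul_left t
  have h3 : t / (1 - t) * F - ∑ i ∈ range 1, (∑ k ∈ range i, f k) * t ^ i =
      t * (F * (1 - t)⁻¹) := by
    simp only [range_one, sum_singleton, range_zero, sum_empty, zero_mul, sub_zero]
    ring
  rw [h3]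
  refine h2.congr_fun fun n => ?_
  rw [sum_mul, mul_sum]
  refine sum_congr rfl fun k hk => ?_
  have hk : k + (n - k) = n := by have := mem_range.mp hk; omega
  rw [mul_assoc, ← pow_add, hk, pow_succ]
  ring

/-- Extraction of a power series coefficient by integration over the circle `|t| = e^{-2c}`,
parametrized by `t = e^{-2(c + iθ)}`. -/
theorem coeff_eq_integral {b : ℕ → ℂ} {F : ℝ → ℂ} (c : ℝ)
    (h : ∀ θ : ℝ, HasSum (fun n => b n * Complex.exp (-2 * (c + θ * Complex.I)) ^ n) (F θ)) (n : ℕ) :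
    b n = (Real.pi : ℂ)⁻¹ * ∫ θ in (-(Real.pi / 2))..(Real.pi / 2),
      F θ * Complex.exp (2 * n * (c + θ * Complex.I)) := by
  have hterm (k : ℕ) (θ : ℝ) : b k * Complex.exp (-2 * (c + θ * Complex.I)) ^ k *
      Complex.exp (2 * n * (c + θ * Complex.I)) =
      b k * Complex.exp (2 * ((n : ℂ) - k) * c) *
        Complex.exp ((2 * ((n : ℂ) - k) * Complex.I) * θ) := by
    simp only [← Complex.exp_nat_mul, mul_assoc (b k), ← Complex.exp_add]
    ring_nf
  have hnorm (k : ℕ) (θ : ℝ) : ‖b k * Complex.exp (-2 * (c + θ * Complex.I)) ^ k *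
      Complex.exp (2 * n * (c + θ * Complex.I))‖ =
      ‖b k * Complex.exp (-2 * (c + (0 : ℝ) * Complex.I)) ^ k‖ * Real.exp (2 * n * c) := by
    simp [Complex.norm_exp]
  -- The norm of each term does not depend on `θ`, so the series at `θ = 0` dominates. All terms but
  -- the `n`-th integrate to zero, since `θ` runs over a full period `π`.
  have hs := intervalIntegral.hasSum_integral_of_dominated_convergence (μ := volume)
    (a := -(Real.pi / 2)) (b := Real.pi / 2)
    (F := fun k θ => b k * Complex.exp (-2 * (c + θ * Complex.I)) ^ k *
      Complex.exp (2 * n * (c + θ * Complex.I)))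
    (f := fun θ => F θ * Complex.exp (2 * n * (c + θ * Complex.I)))
    (fun k _ => ‖b k * Complex.exp (-2 * (c + (0 : ℝ) * Complex.I)) ^ k‖ * Real.exp (2 * n * c))
    (fun k => Continuous.aestronglyMeasurable (by fun_prop))
    (fun k => .of_forall fun θ _ => (hnorm k θ).le)
    (.of_forall fun θ _ => (h 0).summable.norm.mul_right _)
    intervalIntegrable_const
    (.of_forall fun θ _ => (h θ).mul_right _)
  have hint (k : ℕ) (hk : k ≠ n) : ∫ θ in (-(Real.pi / 2))..(Real.pi / 2),
      b k * Complex.exp (-2 * (c + θ * Complex.I)) ^ k *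
        Complex.exp (2 * n * (c + θ * Complex.I)) = 0 := by
    simp only [hterm]
    have hne : (2 * ((n : ℂ) - k) * Complex.I) ≠ 0 := by
      have : (n : ℂ) - k ≠ 0 := sub_ne_zero.mpr (by exact_mod_cast hk.symm)
      simp [this]
    rw [intervalIntegral.integral_const_mul, integral_exp_mul_complex hne]
    have : Complex.exp ((2 * ((n : ℂ) - k) * Complex.I) * ((Real.pi / 2 : ℝ) : ℂ)) =
        Complex.exp ((2 * ((n : ℂ) - k) * Complex.I) * ((-(Real.pi / 2) : ℝ) : ℂ)) := by
      rw [Complex.exp_eq_exp_iff_exists_int]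
      refine ⟨(n : ℤ) - k, ?_⟩
      push_cast
      ring
    rw [this]
    simp
  have hn : ∫ θ in (-(Real.pi / 2))..(Real.pi / 2),
      b n * Complex.exp (-2 * (c + θ * Complex.I)) ^ n *
        Complex.exp (2 * n * (c + θ * Complex.I)) = Real.pi * b n := by
    simp only [hterm]
    simp
  have hpi : (Real.pi : ℂ) ≠ 0 := by exact_mod_cast Real.pi_ne_zero
  rw [(hs.unique (hasSum_single n hint)), hn]
  field_simp

theorem wigner_integral_eq {d : ℕ} {ħ : ℝ} (hħ : 0 < ħ) (N : ℕ)
    (x ξ : EuclideanSpace ℝ (Fin d)) :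
    ∫ v : EuclideanSpace ℝ (Fin d),
      (projKernel d ħ N (x + (1 / 2 : ℝ) • v) (x - (1 / 2 : ℝ) • v) : ℂ) *
        Complex.exp (-(Complex.I / (ħ : ℂ)) * ((inner ℝ v ξ : ℝ) : ℂ)) =
    ∑ α ∈ piAntidiag (univ : Finset (Fin d)) N,
      ∏ j, ((2 * Real.exp (-((x j ^ 2 + ξ j ^ 2) / ħ)) *
        laguerreCoeff (2 * (x j ^ 2 + ξ j ^ 2) / ħ) (α j) : ℝ) : ℂ) := by
  have hmp := EuclideanSpace.volume_preserving_symm_measurableEquiv_toLp (Fin d)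
  rw [← hmp.symm.integral_comp']
  obtain ⟨Φ, hΦ⟩ : ∃ Φ : ℕ → ℝ → ℝ → ℝ → ℂ, ∀ k y η v, Φ k y η v =
      ((hermiteFn ħ k (y + (1 / 2) * v) * hermiteFn ħ k (y - (1 / 2) * v) : ℝ) : ℂ) *
        Complex.exp (-(Complex.I / ħ) * ((v * η : ℝ) : ℂ)) := ⟨_, fun _ _ _ _ => rfl⟩
  have hfun (v : Fin d → ℝ) :
      (projKernel d ħ N (x + (1 / 2 : ℝ) • (WithLp.toLp 2 v))
          (x - (1 / 2 : ℝ) • (WithLp.toLp 2 v)) : ℂ) *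
        Complex.exp (-(Complex.I / (ħ : ℂ)) * ((inner ℝ (WithLp.toLp 2 v) ξ : ℝ) : ℂ)) =
      ∑ α ∈ piAntidiag (univ : Finset (Fin d)) N, ∏ j, Φ (α j) (x j) (ξ j) (v j) := by
    rw [projKernel, PiLp.inner_apply]
    push_cast
    rw [sum_mul]
    refine sum_congr rfl fun α _ => ?_
    simp only [hΦ]
    rw [prod_mul_distrib, ← Complex.exp_sum, ← mul_sum]
    simp [hermiteProd, prod_mul_distrib, mul_comm]
  have hint (k : ℕ) (y η : ℝ) : Integrable (Φ k y η) :=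
    (integrable_hermiteFn_mul hħ k y η).congr (.of_forall fun v => (hΦ k y η v).symm)
  refine (integral_congr_ae (.of_forall hfun)).trans ?_
  rw [integral_finsetSum _ fun α _ => Integrable.fintype_prod_dep fun j => hint (α j) (x j) (ξ j)]
  refine sum_congr rfl fun α _ => ?_
  rw [integral_fintype_prod_volume_eq_prod fun j => Φ (α j) (x j) (ξ j)]
  refine prod_congr rfl fun j _ => ?_
  simp only [hΦ]
  exact integral_hermiteFn_mul hħ (α j) (x j) (ξ j)

theorem exp_neg_two_mul_eq (w : ℂ) : Complex.exp (-2 * w) = Complex.exp (-w) * Complex.exp (-w) := by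
  rw [← Complex.exp_add]; ring_nf

theorem one_add_exp_neg_two_mul (w : ℂ) :
    1 + Complex.exp (-2 * w) = 2 * Complex.exp (-w) * Complex.cosh w := by
  have h : Complex.exp w * Complex.exp (-w) = 1 := by rw [← Complex.exp_add]; simp
  rw [Complex.cosh, exp_neg_two_mul_eq]
  linear_combination -h

theorem one_sub_exp_neg_two_mul (w : ℂ) :
    1 - Complex.exp (-2 * w) = 2 * Complex.exp (-w) * Complex.sinh w := by
  have h : Complex.exp w * Complex.exp (-w) = 1 := by rw [← Complex.exp_add]; simp
  rw [Complex.sinh, exp_neg_two_mul_eq]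
  linear_combination -h

/-- The generating function of one-dimensional Wigner functions in the variable `t = e^{-2w}`. -/
theorem two_mul_generating_eq (r : ℝ) {w : ℂ} (hw : Complex.cosh w ≠ 0) :
    2 * Complex.exp (-r) * ((1 + Complex.exp (-2 * w))⁻¹ *
      Complex.exp (((2 * r : ℝ) : ℂ) * Complex.exp (-2 * w) / (1 + Complex.exp (-2 * w)))) =
    Complex.exp w / Complex.cosh w * Complex.exp (-r * Complex.tanh w) := by
  have he : Complex.exp (-w) ≠ 0 := Complex.exp_ne_zero _
  have h : Complex.exp w * Complex.exp (-w) = 1 := by rw [← Complex.exp_add]; simp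
  have e1 : ((2 * r : ℝ) : ℂ) * Complex.exp (-2 * w) / (1 + Complex.exp (-2 * w)) =
      r + -r * Complex.tanh w := by
    have h0 : 1 + Complex.exp (-2 * w) ≠ 0 := by
      rw [one_add_exp_neg_two_mul]; simp [he, hw]
    rw [Complex.tanh_eq_sinh_div_cosh]
    have : Complex.sinh w / Complex.cosh w =
        (1 - Complex.exp (-2 * w)) / (1 + Complex.exp (-2 * w)) := by
      rw [one_add_exp_neg_two_mul, one_sub_exp_neg_two_mul]
      field_simp
    rw [this]
    generalize Complex.exp (-2 * w) = T at h0
    push_cast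
    field_simp
    ring
  rw [e1, one_add_exp_neg_two_mul, Complex.exp_add]
  have hr : Complex.exp (-r) * Complex.exp r = 1 := by rw [← Complex.exp_add]; simp
  field_simp
  linear_combination hr - h

/-- The contour integral representation of the rescaled bulk Wigner distribution. -/
theorem bulkWigner_eq {d : ℕ} {ħ E : ℝ} (hħ : 0 < ħ) (x ξ : EuclideanSpace ℝ (Fin d)) {c : ℝ}
    (hc : 0 < c) {n : ℕ} (hn : ∀ N, oscEnergy d ħ N ≤ E ↔ N < n) :
    ∃ S : ℝ, bulkWigner d ħ 0 E x ξ = ((((2 * Real.pi * ħ) ^ d)⁻¹ * S : ℝ) : ℂ) ∧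
      (S : ℂ) = ((2 * Real.pi : ℝ) : ℂ)⁻¹ * ∫ θ in (-(Real.pi / 2))..(Real.pi / 2),
        Complex.exp ((2 * n + d - 1) * (c + θ * Complex.I) -
            ((2 * hamiltonian x ξ / ħ : ℝ) : ℂ) * Complex.tanh (c + θ * Complex.I)) *
          (Complex.cosh (c + θ * Complex.I) ^ d * Complex.sinh (c + θ * Complex.I))⁻¹ := by
  set g : Fin d → ℕ → ℝ := fun j k => 2 * Real.exp (-((x j ^ 2 + ξ j ^ 2) / ħ)) *
        laguerreCoeff (2 * (x j ^ 2 + ξ j ^ 2) / ħ) k with hg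
  refine ⟨∑ N ∈ range n, ∑ α ∈ piAntidiag (univ : Finset (Fin d)) N, ∏ j, g j (α j), ?_, ?_⟩
  · have h1 : ∀ N, oscEnergy d ħ N ∈ Set.Icc 0 E ↔ N ∈ range n := fun N => by
      have h0 : 0 ≤ oscEnergy d ħ N := by unfold oscEnergy; positivity
      simp [Set.mem_Icc, h0, hn N]
    simp only [bulkWigner, h1]
    rw [finsum_mem_finset_eq_sum]
    push_cast
    rw [mul_sum]
    refine sum_congr rfl fun N _ => ?_
    rw [wignerEigen, wigner, wigner_integral_eq hħ]
    push_cast [hg]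
    rfl
  · have hgen (θ : ℝ) := hasSum_sum_range
      (f := fun N => ∑ α ∈ piAntidiag (univ : Finset (Fin d)) N, ∏ j, (g j (α j) : ℂ))
      (t := Complex.exp (-2 * (c + θ * Complex.I)))
      (by simp [Complex.norm_exp, hc])
      (hasSum_sum_piAntidiag (fun j k => (g j k : ℂ))
        (F := fun j => 2 * Complex.exp (-((x j ^ 2 + ξ j ^ 2) / ħ : ℝ)) *
          ((1 + Complex.exp (-2 * (c + θ * Complex.I)))⁻¹ *
            Complex.exp (((2 * ((x j ^ 2 + ξ j ^ 2) / ħ) : ℝ) : ℂ) *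
              Complex.exp (-2 * (c + θ * Complex.I)) /
                (1 + Complex.exp (-2 * (c + θ * Complex.I))))))
        (fun j => by
          have h := (hasSum_laguerreCoeff (2 * ((x j ^ 2 + ξ j ^ 2) / ħ))
            (t := Complex.exp (-2 * (c + θ * Complex.I)))
            (by simp [Complex.norm_exp, hc])).mul_left
            (2 * Complex.exp (-((x j ^ 2 + ξ j ^ 2) / ħ : ℝ)))
          refine h.congr_fun fun k => ?_
          simp only [hg]
          rw [← mul_div_assoc]
          push_cast
          ring))
    have hmain := coeff_eq_integral c hgen n
    generalize hμ : 2 * hamiltonian x ξ / ħ = μ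
    push_cast
    rw [hmain, mul_inv, mul_assoc, mul_left_comm, ← intervalIntegral.integral_const_mul (2 : ℂ)⁻¹]
    congr 1
    refine intervalIntegral.integral_congr fun θ _ => ?_
    simp only
    set w : ℂ := c + θ * Complex.I
    have hwre : w.re = c := by simp [w]
    clear_value w
    have ht : ‖Complex.exp (-2 * w)‖ < 1 := by
      rw [Complex.norm_exp]; simp [hwre, hc]
    have hcosh : Complex.cosh w ≠ 0 := by
      intro h0
      have := one_add_exp_neg_two_mul w
      rw [h0, mul_zero] at this
      rw [eq_neg_of_add_eq_zero_right this] at ht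
      simp at ht
    have hsinh : Complex.sinh w ≠ 0 := by
      intro h0
      have := one_sub_exp_neg_two_mul w
      rw [h0, mul_zero] at this
      rw [← sub_eq_zero.mp this] at ht
      simp at ht
    have hham : μ = ∑ j, (x j ^ 2 + ξ j ^ 2) / ħ := by
      rw [← hμ, hamiltonian, EuclideanSpace.real_norm_sq_eq, EuclideanSpace.real_norm_sq_eq,
        ← sum_add_distrib, ← mul_div_assoc, mul_div_cancel_left₀ _ two_ne_zero, sum_div]
    simp only [two_mul_generating_eq _ hcosh]
    -- The exponent `(2n + d - 1)w` collects `2nw` from coefficient extraction, `dw` from the `d`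
    -- factors `e^w / cosh w`, and `-w` from `t/(1-t) = e^{-w}/(2 sinh w)`.
    rw [prod_mul_distrib, ← Complex.exp_sum, prod_const, card_univ, Fintype.card_fin, ← sum_mul,
      sum_neg_distrib, ← Complex.ofReal_sum, ← hham, one_sub_exp_neg_two_mul, exp_neg_two_mul_eq,
      show ((2 * n + d - 1) * w - μ * Complex.tanh w) =
        2 * n * w + (d * w + (-w + -μ * Complex.tanh w)) by ring,
      Complex.exp_add, Complex.exp_add, Complex.exp_add, Complex.exp_nat_mul, div_pow]
    have he : Complex.exp (-w) ≠ 0 := Complex.exp_ne_zero _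
    field_simp

end WignerHermite

/-! ### The Airy function and its primitive on a vertical contour. -/

namespace AiryContour

open MeasureTheory Filter Topology

/-- The integrand `e^{v³/3 - zv}` of the Airy contour integral. -/
noncomputable def airyPhase (z : ℝ) (v : ℂ) : ℂ := Complex.exp (v ^ 3 / 3 - z * v)

theorem airyPhase_differentiable (z : ℝ) : Differentiable ℂ (airyPhase z) := by
  unfold airyPhase; fun_prop

theorem norm_airyPhase (z a y : ℝ) :
    ‖airyPhase z (a + y * Complex.I)‖ = Real.exp (a ^ 3 / 3 - a * y ^ 2 - z * a) := by
  rw [airyPhase, Complex.norm_exp]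
  congr 1
  have : ((a : ℂ) + y * Complex.I) ^ 3 / 3 - z * (a + y * Complex.I) =
      ((a ^ 3 / 3 - a * y ^ 2 - z * a : ℝ) : ℂ) +
        ((a ^ 2 * y - y ^ 3 / 3 - z * y : ℝ) : ℂ) * Complex.I := by
    push_cast
    linear_combination (a * (y : ℂ) ^ 2 + (y : ℂ) ^ 3 / 3 * Complex.I) * Complex.I_sq
  rw [this]
  simp only [Complex.add_re, Complex.ofReal_re, Complex.re_ofReal_mul, Complex.I_re, mul_zero,
    add_zero]

theorem integrable_airyPhase (z : ℝ) {a : ℝ} (ha : 0 < a) :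
    Integrable fun y : ℝ => airyPhase z (a + y * Complex.I) := by
  refine ((integrable_exp_neg_mul_sq ha).const_mul (Real.exp (a ^ 3 / 3 - z * a))).mono'
    (Continuous.aestronglyMeasurable ?_) (.of_forall fun y => ?_)
  · exact (airyPhase_differentiable z).continuous.comp (by fun_prop)
  · rw [norm_airyPhase, ← Real.exp_add]
    apply le_of_eq
    ring_nf

theorem integrableOn_airyRay (z θ : ℝ) (hθ : Complex.exp (θ * Complex.I) ^ 3 = -1) :
    IntegrableOn (fun r : ℝ => airyPhase z (r * Complex.exp (θ * Complex.I)) *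
      Complex.exp (θ * Complex.I)) (Set.Ioi 0) := by
  have hK := abs_nonneg z
  set K := |z| with hKdef
  refine ((integrableOn_exp_neg_Ioi 0).const_mul
    (Real.exp ((K + 1) * (3 * (K + 1) + 1)))).mono' (Continuous.aestronglyMeasurable ?_) ?_
  · exact ((airyPhase_differentiable z).continuous.comp (by fun_prop)).mul continuous_const
  · filter_upwards [ae_restrict_mem measurableSet_Ioi] with r hr
    have hr : 0 < r := hr
    rw [norm_mul, Complex.norm_exp_ofReal_mul_I, mul_one, airyPhase, Complex.norm_exp,
      ← Real.exp_add, Real.exp_le_exp, mul_pow, hθ, Complex.sub_re]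
    have h1 : ((r : ℂ) ^ 3 * -1 / 3).re = -r ^ 3 / 3 := by
      rw [show (r : ℂ) ^ 3 * -1 / 3 = ((-r ^ 3 / 3 : ℝ) : ℂ) by push_cast; ring, Complex.ofReal_re]
    have h2 : -(z * (r * Complex.exp (θ * Complex.I)) : ℂ).re ≤ K * r := by
      refine (neg_le_abs _).trans ((Complex.abs_re_le_norm _).trans ?_)
      rw [norm_mul, norm_mul, Complex.norm_exp_ofReal_mul_I, Complex.norm_real, Complex.norm_real,
        Real.norm_of_nonneg hr.le, mul_one, Real.norm_eq_abs]
    rw [h1]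
    -- For large `r` the cubic term dominates `(|z| + 1) r`; otherwise `r` is bounded and the
    -- constant prefactor pays for it.
    by_cases hcase : 3 * (K + 1) ≤ r ^ 2
    · nlinarith [mul_le_mul_of_nonneg_right hcase hr.le]
    · have : r ≤ 3 * (K + 1) + 1 := by nlinarith
      have h3 : 0 ≤ r ^ 3 / 3 := by positivity
      nlinarith [mul_le_mul_of_nonneg_left this (by linarith : 0 ≤ K + 1)]

/-- This bounds the horizontal segment at height `κx`, `κ = ±√3`, joining the vertical line to the
ray. There the real part of the exponent is `t³/3 - 3tx² - zt ≤ -ax` for large `x`, so the integral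
is at most `x e^{-ax}`. -/
theorem tendsto_primitive_sub (z : ℝ) {a : ℝ} (ha : 0 < a) {G : ℂ → ℂ}
    (hG : ∀ v, HasDerivAt G (airyPhase z v) v) {κ : ℝ} (hκ : κ ^ 2 = 3) :
    Tendsto (fun x : ℝ => G (x + (κ * x : ℝ) * Complex.I) - G (a + (κ * x : ℝ) * Complex.I))
      atTop (𝓝 0) := by
  have hlim : Tendsto (fun x : ℝ => x * Real.exp (-a * x)) atTop (𝓝 0) := by
    simpa using tendsto_rpow_mul_exp_neg_mul_atTop_nhds_zero 1 a ha
  refine squeeze_zero_norm' ?_ hlim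
  filter_upwards [eventually_ge_atTop a, eventually_ge_atTop 1, eventually_ge_atTop |z|]
    with x hxa hx1 hxz
  have hint : ∫ t in a..x, airyPhase z (t + (κ * x : ℝ) * Complex.I) =
      G (x + (κ * x : ℝ) * Complex.I) - G (a + (κ * x : ℝ) * Complex.I) := by
    refine intervalIntegral.integral_eq_sub_of_hasDerivAt (f := fun t : ℝ =>
      G (t + (κ * x : ℝ) * Complex.I)) (fun t _ => ?_) ?_
    · exact ((hG _).comp_add_const (t : ℂ) ((κ * x : ℝ) * Complex.I)).comp_ofReal
    · exact ((airyPhase_differentiable z).continuous.comp (by fun_prop)).intervalIntegrable _ _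
  rw [← hint]
  have hb : ∀ t ∈ Set.uIoc a x, ‖airyPhase z (t + (κ * x : ℝ) * Complex.I)‖ ≤
      Real.exp (-a * x) := by
    intro t ht
    rw [Set.uIoc_of_le hxa] at ht
    rw [norm_airyPhase, Real.exp_le_exp, mul_pow, hκ]
    have ht0 : 0 < t := ha.trans ht.1
    have h1 : t ^ 2 ≤ x ^ 2 := by nlinarith [ht.2]
    have h2 : t ^ 3 ≤ t * x ^ 2 := by nlinarith
    have h3 : -z ≤ x := (neg_le_abs z).trans hxz
    have h4 : -z * t ≤ t * x ^ 2 := by nlinarith [mul_nonneg ht0.le (by nlinarith : 0 ≤ x ^ 2 + z)]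
    have h5 : a * x ≤ t * x ^ 2 := by nlinarith [mul_le_mul ht.1.le (by nlinarith : x ≤ x ^ 2) (by linarith) ht0.le]
    nlinarith
  refine (intervalIntegral.norm_integral_le_of_norm_le_const hb).trans ?_
  rw [abs_of_nonneg (by linarith), mul_comm]
  exact mul_le_mul_of_nonneg_right (by linarith) (Real.exp_pos _).le

/-- The integrand is entire, so it has a global primitive `G`, and deforming the contour amounts to
comparing values of `G` at endpoints. -/
theorem airyRay_sub_airyRay (z : ℝ) {a : ℝ} (ha : 0 < a) :
    airyRay (Real.pi / 3) z - airyRay (-(Real.pi / 3)) z =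
      (∫ y : ℝ, airyPhase z (a + y * Complex.I)) * Complex.I := by
  obtain ⟨G, hG⟩ := (airyPhase_differentiable z).isExactOn_univ
  replace hG : ∀ v, HasDerivAt G (airyPhase z v) v := fun v => by simpa using hG v (Set.mem_univ v)
  have hray (θ κ : ℝ) (hθ : Complex.exp (θ * Complex.I) ^ 3 = -1)
      (hpt : Complex.exp (θ * Complex.I) = 1 / 2 + κ / 2 * Complex.I) :
      Tendsto (fun x : ℝ => G (x + (κ * x : ℝ) * Complex.I) - G 0) atTop (𝓝 (airyRay θ z)) := by
    -- The ray is cut at `r = 2x`, so that its endpoint is `x + iκx`.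
    have h := intervalIntegral_tendsto_integral_Ioi 0 (integrableOn_airyRay z θ hθ)
      (tendsto_id.const_mul_atTop (two_pos : (0 : ℝ) < 2))
    refine h.congr fun x => ?_
    have hd (r : ℝ) : HasDerivAt (fun r : ℝ => G (r * Complex.exp (θ * Complex.I)))
        (airyPhase z (r * Complex.exp (θ * Complex.I)) * Complex.exp (θ * Complex.I)) r := by
      have h1 := ((hasDerivAt_id (r : ℂ)).mul_const (Complex.exp (θ * Complex.I)))
      rw [one_mul] at h1
      exact ((hG _).comp (r : ℂ) h1).comp_ofReal
    rw [intervalIntegral.integral_eq_sub_of_hasDerivAt (fun r _ => hd r)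
      ((((airyPhase_differentiable z).continuous.comp (by fun_prop)).mul
        continuous_const).intervalIntegrable _ _), hpt]
    simp only [id]
    push_cast
    congr 2
    · ring
    · simp
  have hs3 : (Real.sqrt 3) ^ 2 = 3 := Real.sq_sqrt (by norm_num)
  have h1 := hray (Real.pi / 3) (Real.sqrt 3)
    (by rw [← Complex.exp_nat_mul, ← Complex.exp_pi_mul_I]; push_cast; ring_nf)
    (by rw [Complex.exp_mul_I, ← Complex.ofReal_cos, ← Complex.ofReal_sin, Real.cos_pi_div_three,
          Real.sin_pi_div_three]; push_cast; ring)
  have h2 := hray (-(Real.pi / 3)) (-Real.sqrt 3)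
    (by rw [← Complex.exp_nat_mul, ← inv_inj, ← Complex.exp_neg, inv_neg, inv_one,
          ← Complex.exp_pi_mul_I]; push_cast; ring_nf)
    (by rw [Complex.exp_mul_I, ← Complex.ofReal_cos, ← Complex.ofReal_sin, Real.cos_neg,
          Real.sin_neg, Real.cos_pi_div_three, Real.sin_pi_div_three]; push_cast; ring)
  have h3 := (h1.sub h2).sub ((tendsto_primitive_sub z ha hG hs3).sub
    (tendsto_primitive_sub z ha hG (κ := -Real.sqrt 3) (by rw [neg_sq, hs3])))
  have hY : Tendsto (fun x : ℝ => Real.sqrt 3 * x) atTop atTop :=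
    tendsto_id.const_mul_atTop (by positivity)
  have h4 := (intervalIntegral_tendsto_integral (integrable_airyPhase z ha)
    (tendsto_neg_atTop_atBot.comp hY) hY).mul_const Complex.I
  rw [sub_zero, sub_zero] at h3
  refine tendsto_nhds_unique h3 (h4.congr fun x => ?_)
  rw [← intervalIntegral.integral_mul_const]
  have hd (y : ℝ) : HasDerivAt (fun y : ℝ => G (a + y * Complex.I))
      (airyPhase z (a + y * Complex.I) * Complex.I) y := by
    have h5 := ((hasDerivAt_id (y : ℂ)).mul_const Complex.I).const_add (a : ℂ)
    rw [one_mul] at h5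
    exact ((hG _).comp (y : ℂ) h5).comp_ofReal
  rw [intervalIntegral.integral_eq_sub_of_hasDerivAt (fun y _ => hd y)
    ((((airyPhase_differentiable z).continuous.comp (by fun_prop)).mul
        continuous_const).intervalIntegrable _ _)]
  simp only [Function.comp, neg_mul]
  ring

theorem airyAi_eq (z : ℝ) {a : ℝ} (ha : 0 < a) :
    airyAi z = (2 * Real.pi)⁻¹ * (∫ y : ℝ, airyPhase z (a + y * Complex.I)).re := by
  rw [airyAi, airyRay_sub_airyRay z ha, mul_div_mul_right _ _ Complex.I_ne_zero, div_eq_inv_mul,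
    ← Complex.re_ofReal_mul]
  push_cast
  rfl

/-- The primitive of the Airy function as an absolutely convergent contour integral. -/
theorem integral_airyAi (s : ℝ) {a : ℝ} (ha : 0 < a) :
    ∫ τ in Set.Ioi (0 : ℝ), airyAi (s + τ) =
      (2 * Real.pi)⁻¹ * (∫ y : ℝ, airyPhase s (a + y * Complex.I) / (a + y * Complex.I)).re := by
  have hexp (τ y : ℝ) : airyPhase (s + τ) (a + y * Complex.I) =
      airyPhase s (a + y * Complex.I) * Complex.exp (-(a + y * Complex.I) * τ) := by
    rw [airyPhase, airyPhase, ← Complex.exp_add]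
    push_cast
    ring_nf
  -- Fubini applies because `|e^{-vτ}| = e^{-aτ}` on the line `Re v = a > 0`; the `τ`-integral then
  -- produces the factor `1/v`.
  have hF : Integrable (Function.uncurry fun τ y : ℝ => airyPhase (s + τ) (a + y * Complex.I))
      ((volume.restrict (Set.Ioi 0)).prod volume) := by
    have h1 : Integrable (fun τ : ℝ => Real.exp (-a * τ)) (volume.restrict (Set.Ioi 0)) :=
      integrableOn_exp_mul_Ioi (by linarith) 0
    refine (h1.mul_prod (integrable_airyPhase s ha).norm).mono'
      (Continuous.aestronglyMeasurable ?_) (.of_forall fun p => ?_)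
    · unfold airyPhase Function.uncurry; fun_prop
    · rw [Function.uncurry, hexp, norm_mul, mul_comm]
      gcongr
      rw [Complex.norm_exp]
      simp
  have hinner (y : ℝ) : ∫ τ in Set.Ioi (0 : ℝ), airyPhase (s + τ) (a + y * Complex.I) =
      airyPhase s (a + y * Complex.I) / (a + y * Complex.I) := by
    simp only [hexp]
    rw [integral_const_mul, integral_exp_mul_complex_Ioi (by simpa using ha), neg_div_neg_eq]
    simp [div_eq_mul_inv]
  simp only [airyAi_eq _ ha]
  have hre := integral_re hF.integral_prod_left
  simp only [Function.uncurry] at hre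
  rw [integral_const_mul, ← RCLike.re_eq_complex_re, hre, integral_integral_swap hF]
  simp only [hinner]

end AiryContour

/-! ### Bounds for hyperbolic functions on the contour. -/

namespace WignerContour

open MeasureTheory

theorem normSq_cosh (c θ : ℝ) :
    Complex.normSq (Complex.cosh (c + θ * Complex.I)) = Real.cosh c ^ 2 - Real.sin θ ^ 2 := by
  rw [Complex.cosh_add, Complex.cosh_mul_I, Complex.sinh_mul_I, ← Complex.ofReal_cosh,
    ← Complex.ofReal_sinh, ← Complex.ofReal_cos, ← Complex.ofReal_sin, ← mul_assoc,
    ← Complex.ofReal_mul, ← Complex.ofReal_mul, Complex.normSq_add_mul_I]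
  have h1 := Real.cosh_sq c
  have h2 := Real.sin_sq_add_cos_sq θ
  linear_combination (Real.sin θ ^ 2) * (-h1) + Real.cosh c ^ 2 * h2

theorem normSq_sinh (c θ : ℝ) :
    Complex.normSq (Complex.sinh (c + θ * Complex.I)) = Real.sinh c ^ 2 + Real.sin θ ^ 2 := by
  rw [Complex.sinh_add, Complex.cosh_mul_I, Complex.sinh_mul_I, ← Complex.ofReal_cosh,
    ← Complex.ofReal_sinh, ← Complex.ofReal_cos, ← Complex.ofReal_sin, ← mul_assoc,
    ← Complex.ofReal_mul, ← Complex.ofReal_mul, Complex.normSq_add_mul_I]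
  have h1 := Real.cosh_sq c
  have h2 := Real.sin_sq_add_cos_sq θ
  linear_combination (Real.sin θ ^ 2) * h1 + Real.sinh c ^ 2 * h2

theorem re_tanh (c θ : ℝ) : (Complex.tanh (c + θ * Complex.I)).re =
    Real.sinh c * Real.cosh c / (Real.cosh c ^ 2 - Real.sin θ ^ 2) := by
  rw [Complex.tanh_eq_sinh_div_cosh, Complex.div_re, normSq_cosh]
  rw [Complex.cosh_add, Complex.sinh_add, Complex.cosh_mul_I, Complex.sinh_mul_I,
    ← Complex.ofReal_cosh, ← Complex.ofReal_sinh, ← Complex.ofReal_cos, ← Complex.ofReal_sin]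
  simp only [Complex.add_re, Complex.mul_re, Complex.ofReal_re, Complex.ofReal_im, Complex.I_re,
    Complex.I_im, Complex.add_im, Complex.mul_im]
  have h2 := Real.sin_sq_add_cos_sq θ
  rw [← add_div]
  congr 1
  linear_combination Real.sinh c * Real.cosh c * h2

/-- For `c ≤ 1`, `cosh c ≤ e^{c²}` and `1 - c² ≤ e^{-c²}` give `(1 - c²) cosh c ≤ 1`, and `c ≤ sinh
c`. For `c > 1` the left side is negative. -/
theorem sub_cube_le_tanh {c : ℝ} (hc : 0 ≤ c) : c - c ^ 3 ≤ Real.sinh c / Real.cosh c := by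
  rw [le_div_iff₀ (Real.cosh_pos c)]
  by_cases h1 : c ≤ 1
  · have h2 : Real.cosh c ≤ Real.exp (c ^ 2 / 2) := Real.cosh_le_exp_half_sq c
    have h3 : Real.exp (c ^ 2 / 2) ≤ Real.exp (c ^ 2) := Real.exp_le_exp.mpr (by nlinarith [sq_nonneg c])
    have h4 : 1 - c ^ 2 ≤ Real.exp (-c ^ 2) := by
      have := Real.add_one_le_exp (-c ^ 2); linarith
    have h5 : (1 - c ^ 2) * Real.cosh c ≤ 1 := by
      calc (1 - c ^ 2) * Real.cosh c ≤ Real.exp (-c ^ 2) * Real.exp (c ^ 2) := by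
            apply mul_le_mul h4 (h2.trans h3) (Real.cosh_pos c).le (Real.exp_pos _).le
        _ = 1 := by rw [← Real.exp_add]; simp
    have h6 : c ≤ Real.sinh c := Real.self_le_sinh_iff.mpr hc
    nlinarith
  · have h6 : 0 ≤ Real.sinh c := Real.sinh_nonneg_iff.mpr hc
    have h7 : c - c ^ 3 ≤ 0 := by nlinarith [sq_nonneg c]
    nlinarith [Real.cosh_pos c]

theorem cosh_sq_le_three {c : ℝ} (hc : |c| ≤ 1) : Real.cosh c ^ 2 ≤ 3 := by
  have h := Real.cosh_le_exp_half_sq c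
  have h2 : Real.exp (c ^ 2 / 2) ^ 2 ≤ Real.exp 1 := by
    rw [← Real.exp_nat_mul, Real.exp_le_exp]
    push_cast
    nlinarith [sq_abs c, abs_nonneg c]
  have := Real.exp_one_lt_d9
  nlinarith [Real.cosh_pos c]

theorem half_le_tanh {c : ℝ} (hc : 0 ≤ c) (hc1 : c ≤ 1) : c / 2 ≤ Real.sinh c / Real.cosh c := by
  rw [le_div_iff₀ (Real.cosh_pos c)]
  have h := cosh_sq_le_three (c := c) (by rw [abs_of_nonneg hc]; exact hc1)
  have h2 : Real.cosh c ≤ 2 := by nlinarith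
  have h6 : c ≤ Real.sinh c := Real.self_le_sinh_iff.mpr hc
  nlinarith

/-- Quantitative Taylor bounds for `sinh` and `cosh` near the origin. -/
theorem taylor_sinh_cosh {w : ℂ} (hw : ‖w‖ ≤ 2) :
    ‖Complex.sinh w - (w + w ^ 3 / 6)‖ ≤ 8 * ‖w‖ ^ 5 ∧
      ‖Complex.cosh w - (1 + w ^ 2 / 2 + w ^ 4 / 24)‖ ≤ 8 * ‖w‖ ^ 5 := by
  have he : Real.exp ‖w‖ ≤ 8 := by
    have h1 : Real.exp ‖w‖ ≤ Real.exp 2 := Real.exp_le_exp.mpr hw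
    have h2 : Real.exp 2 = Real.exp 1 * Real.exp 1 := by rw [← Real.exp_add]; norm_num
    have := Real.exp_one_lt_d9
    nlinarith [Real.exp_pos 1]
  have key : ∀ v : ℂ, ‖v‖ = ‖w‖ →
      ‖Complex.exp v - (1 + v + v ^ 2 / 2 + v ^ 3 / 6 + v ^ 4 / 24)‖ ≤ 8 * ‖w‖ ^ 5 := by
    intro v hv
    have h := Complex.norm_exp_sub_sum_le_norm_mul_exp v 5
    simp only [Finset.sum_range_succ, Finset.sum_range_zero, Nat.factorial] at h
    rw [hv] at h
    norm_num at h
    refine h.trans ?_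
    rw [mul_comm]
    gcongr
  have h1 := key w rfl
  have h2 := key (-w) (norm_neg w)
  rw [Complex.sinh, Complex.cosh]
  constructor
  · calc _ = ‖((Complex.exp w - (1 + w + w ^ 2 / 2 + w ^ 3 / 6 + w ^ 4 / 24)) -
        (Complex.exp (-w) - (1 + -w + (-w) ^ 2 / 2 + (-w) ^ 3 / 6 + (-w) ^ 4 / 24))) / 2‖ := by
          congr 1; ring
      _ ≤ _ := by
        rw [norm_div, Complex.norm_two]
        linarith [norm_sub_le (Complex.exp w - (1 + w + w ^ 2 / 2 + w ^ 3 / 6 + w ^ 4 / 24))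
          (Complex.exp (-w) - (1 + -w + (-w) ^ 2 / 2 + (-w) ^ 3 / 6 + (-w) ^ 4 / 24))]
  · calc _ = ‖((Complex.exp w - (1 + w + w ^ 2 / 2 + w ^ 3 / 6 + w ^ 4 / 24)) +
        (Complex.exp (-w) - (1 + -w + (-w) ^ 2 / 2 + (-w) ^ 3 / 6 + (-w) ^ 4 / 24))) / 2‖ := by
          congr 1; ring
      _ ≤ _ := by
        rw [norm_div, Complex.norm_two]
        linarith [norm_add_le (Complex.exp w - (1 + w + w ^ 2 / 2 + w ^ 3 / 6 + w ^ 4 / 24))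
          (Complex.exp (-w) - (1 + -w + (-w) ^ 2 / 2 + (-w) ^ 3 / 6 + (-w) ^ 4 / 24))]

theorem norm_tanh_sub_taylor_le {w : ℂ} (hw : ‖w‖ ≤ 2) (hC : 1 / 2 ≤ ‖Complex.cosh w‖) :
    ‖Complex.tanh w - w + w ^ 3 / 3‖ ≤ 100 * ‖w‖ ^ 5 := by
  obtain ⟨hs, hc⟩ := taylor_sinh_cosh hw
  have hC0 : Complex.cosh w ≠ 0 := by
    intro h; rw [h, norm_zero] at hC; norm_num at hC
  set S := Complex.sinh w - (w + w ^ 3 / 6) with hS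
  set R := Complex.cosh w - (1 + w ^ 2 / 2 + w ^ 4 / 24) with hR
  -- Over the common denominator `cosh w`, all powers of `w` below the fifth cancel.
  have hnum : Complex.tanh w - w + w ^ 3 / 3 =
      (w ^ 5 / 8 + w ^ 7 / 72 + S - w * R + w ^ 3 * R / 3) / Complex.cosh w := by
    rw [Complex.tanh_eq_sinh_div_cosh, eq_div_iff hC0]
    field_simp
    rw [hS, hR]
    ring
  rw [hnum, norm_div, div_le_iff₀ (by linarith)]
  have hw0 := norm_nonneg w
  have hw2 : ‖w‖ ^ 2 ≤ 4 := by nlinarith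
  have hw3 : ‖w‖ ^ 3 ≤ 8 := by nlinarith
  have hw5 : 0 ≤ ‖w‖ ^ 5 := by positivity
  have h1 : ‖w ^ 5 / 8‖ = ‖w‖ ^ 5 / 8 := by rw [norm_div, norm_pow]; norm_num
  have h2 : ‖w ^ 7 / 72‖ = ‖w‖ ^ 5 * ‖w‖ ^ 2 / 72 := by
    rw [norm_div, norm_pow, ← pow_add]; norm_num
  have h3 : ‖w * R‖ ≤ 2 * (8 * ‖w‖ ^ 5) := by rw [norm_mul]; gcongr
  have h4 : ‖w ^ 3 * R / 3‖ ≤ 8 * (8 * ‖w‖ ^ 5) / 3 := by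
    rw [norm_div, norm_mul, norm_pow, show ‖(3 : ℂ)‖ = 3 by norm_num]; gcongr
  have h5 : ‖w ^ 5 / 8 + w ^ 7 / 72 + S - w * R + w ^ 3 * R / 3‖ ≤
      ‖w ^ 5 / 8‖ + ‖w ^ 7 / 72‖ + ‖S‖ + ‖w * R‖ + ‖w ^ 3 * R / 3‖ :=
    (norm_add_le _ _).trans (add_le_add_left ((norm_sub_le _ _).trans
      (add_le_add_left ((norm_add_le _ _).trans (add_le_add_left (norm_add_le _ _) _)) _)) _)
  have h6 : ‖w‖ ^ 5 * ‖w‖ ^ 2 ≤ ‖w‖ ^ 5 * 4 := by gcongr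
  have h7 : 100 * ‖w‖ ^ 5 * (1 / 2) ≤ 100 * ‖w‖ ^ 5 * ‖Complex.cosh w‖ := by gcongr
  linarith

theorem norm_tanh_sub_le {w : ℂ} (hw : ‖w‖ ≤ 2) (hC : 1 / 2 ≤ ‖Complex.cosh w‖) :
    ‖Complex.tanh w - w‖ ≤ 401 * ‖w‖ ^ 3 := by
  have h := norm_tanh_sub_taylor_le hw hC
  have h1 : ‖Complex.tanh w - w‖ ≤ ‖Complex.tanh w - w + w ^ 3 / 3‖ + ‖w ^ 3 / 3‖ := by
    have := norm_sub_le (Complex.tanh w - w + w ^ 3 / 3) (w ^ 3 / 3)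
    rwa [add_sub_cancel_right] at this
  have h2 : ‖w ^ 3 / 3‖ = ‖w‖ ^ 3 / 3 := by rw [norm_div, norm_pow]; norm_num
  have h3 : ‖w‖ ^ 5 ≤ 4 * ‖w‖ ^ 3 := by
    have : ‖w‖ ^ 2 ≤ 4 := by nlinarith [norm_nonneg w]
    calc ‖w‖ ^ 5 = ‖w‖ ^ 2 * ‖w‖ ^ 3 := by ring
      _ ≤ 4 * ‖w‖ ^ 3 := by gcongr
  have h4 : 0 ≤ ‖w‖ ^ 3 := by positivity
  linarith

/-- The amplitude has a simple pole with residue 1 at the origin. The difference is `(w - cosh^d w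
sinh w) / (cosh^d w sinh w · w)`, with numerator `O(|w|²)` and denominator bounded below by a
multiple of `|w|²`. -/
theorem exists_amplitude_bound (d : ℕ) : ∃ K : ℝ, 0 ≤ K ∧ ∀ w : ℂ, ‖w‖ ≤ 2 →
    1 / 2 ≤ ‖Complex.cosh w‖ → ‖w‖ / 2 ≤ ‖Complex.sinh w‖ → w ≠ 0 →
    ‖(Complex.cosh w ^ d * Complex.sinh w)⁻¹ - w⁻¹‖ ≤ K := by
  set G : ℝ := ∑ i ∈ Finset.range d, (261 : ℝ) ^ i
  have hG : 0 ≤ G := by positivity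
  refine ⟨(65 + 130 * (130 * G)) * (2 * 2 ^ d), by positivity, fun w hw hC hS hw0 => ?_⟩
  obtain ⟨hs, hc⟩ := taylor_sinh_cosh hw
  have hr : 0 < ‖w‖ := norm_pos_iff.mpr hw0
  have hC0 : Complex.cosh w ≠ 0 := by
    intro h; rw [h, norm_zero] at hC; norm_num at hC
  have hS0 : Complex.sinh w ≠ 0 := by
    intro h; rw [h, norm_zero] at hS; linarith
  have h5 : ‖w‖ ^ 5 ≤ 16 * ‖w‖ := by
    have : ‖w‖ ^ 4 ≤ 2 ^ 4 := by gcongr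
    calc ‖w‖ ^ 5 = ‖w‖ ^ 4 * ‖w‖ := by ring
      _ ≤ 2 ^ 4 * ‖w‖ := by gcongr
      _ = _ := by ring
  have h52 : ‖w‖ ^ 5 ≤ 8 * ‖w‖ ^ 2 := by
    have : ‖w‖ ^ 3 ≤ 2 ^ 3 := by gcongr
    calc ‖w‖ ^ 5 = ‖w‖ ^ 3 * ‖w‖ ^ 2 := by ring
      _ ≤ 2 ^ 3 * ‖w‖ ^ 2 := by gcongr
      _ = _ := by ring
  have h32 : ‖w‖ ^ 3 ≤ 2 * ‖w‖ ^ 2 := by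
    calc ‖w‖ ^ 3 = ‖w‖ * ‖w‖ ^ 2 := by ring
      _ ≤ 2 * ‖w‖ ^ 2 := by gcongr
  have h21 : ‖w‖ ^ 2 ≤ 2 * ‖w‖ := by nlinarith
  have h31 : ‖w‖ ^ 3 ≤ 4 * ‖w‖ := by linarith
  have h41 : ‖w‖ ^ 4 ≤ 8 * ‖w‖ := by
    calc ‖w‖ ^ 4 = ‖w‖ ^ 3 * ‖w‖ := by ring
      _ ≤ 2 ^ 3 * ‖w‖ := by gcongr
      _ = _ := by ring
  have hw3 : ‖w ^ 3 / 6‖ = ‖w‖ ^ 3 / 6 := by rw [norm_div, norm_pow]; norm_num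
  have e1 : ‖w - Complex.sinh w‖ ≤ 65 * ‖w‖ ^ 2 := by
    have : w - Complex.sinh w = -(Complex.sinh w - (w + w ^ 3 / 6)) - w ^ 3 / 6 := by ring
    rw [this]
    refine (norm_sub_le _ _).trans ?_
    rw [norm_neg, hw3]
    linarith [sq_nonneg ‖w‖]
  have e2 : ‖Complex.sinh w‖ ≤ 130 * ‖w‖ := by
    have : Complex.sinh w = (Complex.sinh w - (w + w ^ 3 / 6)) + (w + w ^ 3 / 6) := by ring
    rw [this]
    refine (norm_add_le _ _).trans ?_
    have := norm_add_le w (w ^ 3 / 6)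
    rw [hw3] at this
    linarith
  have e3 : ‖1 - Complex.cosh w‖ ≤ 130 * ‖w‖ := by
    have : 1 - Complex.cosh w = -(Complex.cosh w - (1 + w ^ 2 / 2 + w ^ 4 / 24)) -
      (w ^ 2 / 2 + w ^ 4 / 24) := by ring
    rw [this]
    refine (norm_sub_le _ _).trans ?_
    have h2 := norm_add_le (w ^ 2 / 2) (w ^ 4 / 24)
    have h3 : ‖w ^ 2 / 2‖ = ‖w‖ ^ 2 / 2 := by rw [norm_div, norm_pow]; norm_num
    have h4 : ‖w ^ 4 / 24‖ = ‖w‖ ^ 4 / 24 := by rw [norm_div, norm_pow]; norm_num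
    rw [norm_neg]
    linarith
  have e4 : ‖Complex.cosh w‖ ≤ 261 := by
    have : Complex.cosh w = 1 - (1 - Complex.cosh w) := by ring
    rw [this]
    refine (norm_sub_le _ _).trans ?_
    rw [norm_one]
    linarith
  have e5 : ‖1 - Complex.cosh w ^ d‖ ≤ 130 * ‖w‖ * G := by
    rw [← mul_neg_geom_sum, norm_mul]
    refine mul_le_mul e3 ?_ (norm_nonneg _) (by positivity)
    refine (norm_sum_le _ _).trans (Finset.sum_le_sum fun i _ => ?_)
    rw [norm_pow]
    gcongr
  have e6 : ‖w - Complex.cosh w ^ d * Complex.sinh w‖ ≤ (65 + 130 * (130 * G)) * ‖w‖ ^ 2 := by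
    have : w - Complex.cosh w ^ d * Complex.sinh w =
        (w - Complex.sinh w) + Complex.sinh w * (1 - Complex.cosh w ^ d) := by ring
    rw [this]
    refine (norm_add_le _ _).trans ?_
    rw [norm_mul]
    have := mul_le_mul e2 e5 (norm_nonneg _) (by positivity)
    calc _ ≤ 65 * ‖w‖ ^ 2 + 130 * ‖w‖ * (130 * ‖w‖ * G) := add_le_add e1 this
      _ = _ := by ring
  have e7 : (Complex.cosh w ^ d * Complex.sinh w)⁻¹ - w⁻¹ =
      (w - Complex.cosh w ^ d * Complex.sinh w) / (Complex.cosh w ^ d * Complex.sinh w * w) := by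
    field_simp
  have e8 : ‖w‖ ^ 2 ≤ 2 * 2 ^ d * ‖Complex.cosh w ^ d * Complex.sinh w * w‖ := by
    rw [norm_mul, norm_mul, norm_pow]
    have : (1 / 2 : ℝ) ^ d * (‖w‖ / 2) ≤ ‖Complex.cosh w‖ ^ d * ‖Complex.sinh w‖ := by gcongr
    have h2 : (2 : ℝ) ^ d * (1 / 2) ^ d = 1 := by rw [← mul_pow]; norm_num
    calc ‖w‖ ^ 2 = 2 * (2 ^ d * (1 / 2) ^ d) * (‖w‖ / 2) * ‖w‖ := by rw [h2]; ring
      _ = 2 * 2 ^ d * ((1 / 2) ^ d * (‖w‖ / 2) * ‖w‖) := by ring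
      _ ≤ _ := by gcongr
  rw [e7, norm_div, div_le_iff₀ (by rw [norm_pos_iff]; positivity)]
  refine e6.trans ?_
  calc _ ≤ (65 + 130 * (130 * G)) *
        (2 * 2 ^ d * ‖Complex.cosh w ^ d * Complex.sinh w * w‖) := by gcongr
    _ = _ := by ring

end WignerContour

/-! ### Scaling regime and decay of the two integrands. -/

namespace WignerContour

open MeasureTheory

/-- The admissible range of parameters: `Λ³` is the rescaled energy, `Λ³ + sΛ` the rescaled value of
the Hamiltonian, `m` the exponent in the contour integral and `a` the height of the contour in the
Airy scale. -/
structure Admissible (d : ℕ) (K Λ a s m : ℝ) : Prop where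
  one_le_K : 1 ≤ K
  Λ_pos : 0 < Λ
  a_pos : 0 < a
  a_le_one : a ≤ 1
  a_le_Λ : a ≤ Λ
  s_le : |s| * a ≤ K
  le_μ : Λ ^ 3 ≤ K * (Λ ^ 3 + s * Λ)
  μ_le : Λ ^ 3 + s * Λ ≤ K * Λ ^ 3
  m_sub : |m - Λ ^ 3| ≤ d
  one_le_g : 1 ≤ K * (Λ ^ 2 * a)

/-- The contour `c + iθ`. -/
noncomputable def vert (c θ : ℝ) : ℂ := c + θ * Complex.I

theorem vert_re (c θ : ℝ) : (vert c θ).re = c := by simp [vert]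

theorem norm_vert_sq (c θ : ℝ) : ‖vert c θ‖ ^ 2 = c ^ 2 + θ ^ 2 := by
  rw [← Complex.normSq_eq_norm_sq, vert, Complex.normSq_add_mul_I]

/-- The exact phase of the contour integral. -/
noncomputable def oscPhase (m μ : ℝ) (w : ℂ) : ℂ := m * w - μ * Complex.tanh w

/-- The phase of the Airy model. -/
noncomputable def modelPhase (Λ s : ℝ) (w : ℂ) : ℂ := (Λ * w) ^ 3 / 3 - s * (Λ * w)

theorem re_modelPhase (Λ s c θ : ℝ) : (modelPhase Λ s (vert c θ)).re =
    (Λ * c) ^ 3 / 3 - s * (Λ * c) - Λ ^ 3 * c * θ ^ 2 := by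
  have : modelPhase Λ s (vert c θ) =
      (((Λ * c) ^ 3 / 3 - s * (Λ * c) - Λ ^ 3 * c * θ ^ 2 : ℝ) : ℂ) +
        ((Λ ^ 3 * c ^ 2 * θ - Λ ^ 3 * θ ^ 3 / 3 - s * Λ * θ : ℝ) : ℂ) * Complex.I := by
    rw [modelPhase, vert]
    push_cast
    linear_combination ((Λ : ℂ) ^ 3 * c * θ ^ 2 + (Λ : ℂ) ^ 3 * θ ^ 3 / 3 * Complex.I) *
      Complex.I_sq
  rw [this]
  simp only [Complex.add_re, Complex.ofReal_re, Complex.re_ofReal_mul, Complex.I_re, mul_zero,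
    add_zero]

theorem two_fifths_mul_sq_le_sin_sq {θ : ℝ} (h : |θ| ≤ Real.pi / 2) :
    2 / 5 * θ ^ 2 ≤ Real.sin θ ^ 2 := by
  have h1 := Real.mul_le_sin (abs_nonneg θ) h
  have h2 : Real.sin |θ| ^ 2 = Real.sin θ ^ 2 := by
    rcases abs_cases θ with ⟨h, _⟩ | ⟨h, _⟩ <;> simp [h]
  have h0 : 0 ≤ 2 / Real.pi * |θ| := by positivity
  have h3 : (2 / Real.pi * |θ|) ^ 2 ≤ Real.sin |θ| ^ 2 := by gcongr
  have h4 : 2 / 5 ≤ (2 / Real.pi) ^ 2 := by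
    rw [div_pow, div_le_div_iff₀ (by norm_num) (by positivity)]
    nlinarith [Real.pi_lt_d2, Real.pi_gt_three]
  rw [h2, mul_pow, sq_abs] at h3
  nlinarith [sq_nonneg θ]

namespace Admissible

variable {d : ℕ} {K Λ a s m : ℝ} (h : Admissible d K Λ a s m)

include h

theorem K_pos : 0 < K := zero_lt_one.trans_le h.one_le_K

theorem c_pos : 0 < a / Λ := div_pos h.a_pos h.Λ_pos

theorem c_le_one : a / Λ ≤ 1 := (div_le_one h.Λ_pos).mpr h.a_le_Λ

theorem Λ_mul_c : Λ * (a / Λ) = a := mul_div_cancel₀ a h.Λ_pos.ne'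

theorem g_pos : 0 < Λ ^ 2 * a := mul_pos (pow_pos h.Λ_pos 2) h.a_pos

theorem g_eq : Λ ^ 3 * (a / Λ) = Λ ^ 2 * a := by
  have := h.Λ_pos.ne'
  field_simp

theorem g_le_μc : Λ ^ 2 * a ≤ K * ((Λ ^ 3 + s * Λ) * (a / Λ)) := by
  rw [← h.g_eq, ← mul_assoc]
  exact mul_le_mul_of_nonneg_right h.le_μ h.c_pos.le

theorem μ_pos : 0 < Λ ^ 3 + s * Λ := by
  have h1 := h.le_μ
  have h2 := pow_pos h.Λ_pos 3
  by_contra hneg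
  nlinarith [h.K_pos]

theorem ρ_pos (θ : ℝ) : 0 < Real.cosh (a / Λ) ^ 2 - Real.sin θ ^ 2 := by
  have h1 := Real.cosh_sq (a / Λ)
  have h2 : 0 < Real.sinh (a / Λ) := Real.sinh_pos_iff.mpr h.c_pos
  nlinarith [Real.sin_sq_le_one θ]

/-- With `q = sin²θ / (cosh²c - sin²θ)`, `Re tanh(c + iθ) = tanh c · (1 + q)`. The bound `tanh c ≥ c
- c³` cancels the main term `mc` up to `d + 2K`, and `tanh c ≥ c/2` supplies the decay in `q`.
Keeping `q` matters: it blows up near `θ = ±π/2` as `c → 0`. -/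
theorem re_oscPhase_le (θ : ℝ) :
    (oscPhase m (Λ ^ 3 + s * Λ) (vert (a / Λ) θ)).re ≤ d + 2 * K -
      (Λ ^ 3 + s * Λ) * (a / Λ) / 2 *
        (Real.sin θ ^ 2 / (Real.cosh (a / Λ) ^ 2 - Real.sin θ ^ 2)) := by
  have hμ := h.μ_pos
  have hρ := h.ρ_pos θ
  have hc := h.c_pos
  have hc1 := h.c_le_one
  have hΛc := h.Λ_mul_c
  have hre : (oscPhase m (Λ ^ 3 + s * Λ) (vert (a / Λ) θ)).re =
      m * (a / Λ) - (Λ ^ 3 + s * Λ) * (Real.sinh (a / Λ) * Real.cosh (a / Λ) /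
        (Real.cosh (a / Λ) ^ 2 - Real.sin θ ^ 2)) := by
    rw [oscPhase, Complex.sub_re, Complex.re_ofReal_mul, Complex.re_ofReal_mul, vert_re, vert,
      re_tanh]
  rw [hre]
  set c := a / Λ
  set μ := Λ ^ 3 + s * Λ with hμdef
  set t := Real.sinh c / Real.cosh c with ht
  have hcosh := Real.cosh_pos c
  have e1 : Real.sinh c * Real.cosh c / (Real.cosh c ^ 2 - Real.sin θ ^ 2) =
      t + t * (Real.sin θ ^ 2 / (Real.cosh c ^ 2 - Real.sin θ ^ 2)) := by
    rw [ht]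
    field_simp
    ring
  have e2 := sub_cube_le_tanh hc.le
  have e3 := half_le_tanh hc.le hc1
  set q := Real.sin θ ^ 2 / (Real.cosh c ^ 2 - Real.sin θ ^ 2)
  have hq : 0 ≤ q := by positivity
  have e4 : μ * (c - c ^ 3 + c / 2 * q) ≤ μ * (t + t * q) := by gcongr
  have e5 : (m - Λ ^ 3) * c ≤ d := by
    have h1 : (m - Λ ^ 3) * c ≤ |m - Λ ^ 3| * c :=
      mul_le_mul_of_nonneg_right (le_abs_self _) hc.le
    have h2 : |m - Λ ^ 3| * c ≤ d * 1 := mul_le_mul h.m_sub hc1 hc.le (Nat.cast_nonneg d)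
    linarith
  have e6 : -(s * Λ * c) ≤ K := by
    rw [mul_assoc, hΛc]
    have h1 : -(s * a) ≤ |s| * a := by nlinarith [neg_le_abs s, h.a_pos]
    linarith [h.s_le]
  have e7 : μ * c ^ 3 ≤ K := by
    calc μ * c ^ 3 ≤ K * Λ ^ 3 * c ^ 3 := by gcongr; exact h.μ_le
      _ = K * (Λ * c) ^ 3 := by ring
      _ = K * a ^ 3 := by rw [hΛc]
      _ ≤ K * 1 := by
        gcongr
        · exact h.K_pos.le
        · exact pow_le_one₀ h.a_pos.le h.a_le_one
      _ = K := mul_one K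
  rw [e1]
  nlinarith

theorem norm_exp_oscPhase_le {θ : ℝ} (hθ : |θ| ≤ Real.pi / 2) :
    ‖Complex.exp (oscPhase m (Λ ^ 3 + s * Λ) (vert (a / Λ) θ))‖ ≤
      Real.exp (d + 2 * K) * Real.exp (-(Λ ^ 2 * a / (20 * K) * θ ^ 2)) := by
  rw [Complex.norm_exp, ← Real.exp_add, Real.exp_le_exp]
  refine (h.re_oscPhase_le θ).trans ?_
  have h1 := two_fifths_mul_sq_le_sin_sq hθ
  have h2 := cosh_sq_le_three (c := a / Λ) (by rw [abs_of_pos h.c_pos]; exact h.c_le_one)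
  have hρ := h.ρ_pos θ
  have hK := h.K_pos
  have h3 : 2 / 15 * θ ^ 2 ≤ Real.sin θ ^ 2 / (Real.cosh (a / Λ) ^ 2 - Real.sin θ ^ 2) := by
    rw [le_div_iff₀ hρ]
    nlinarith [sq_nonneg θ, sq_nonneg (Real.sin θ)]
  have h4 : Λ ^ 2 * a / K ≤ (Λ ^ 3 + s * Λ) * (a / Λ) := by
    rw [div_le_iff₀ hK, mul_comm _ K]; exact h.g_le_μc
  have h5 : 0 ≤ (Λ ^ 3 + s * Λ) * (a / Λ) := mul_nonneg h.μ_pos.le h.c_pos.le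
  have h6 : Λ ^ 2 * a / (20 * K) * θ ^ 2 ≤ (Λ ^ 3 + s * Λ) * (a / Λ) / 2 * (2 / 15 * θ ^ 2) := by
    calc Λ ^ 2 * a / (20 * K) * θ ^ 2 = Λ ^ 2 * a / K * (1 / 20) * θ ^ 2 := by
          field_simp
      _ ≤ (Λ ^ 3 + s * Λ) * (a / Λ) * (1 / 15) * θ ^ 2 := by gcongr; norm_num
      _ = _ := by ring
  have h7 := mul_le_mul_of_nonneg_left h3 (half_pos (h5.lt_of_ne' (mul_pos h.μ_pos h.c_pos).ne')).le
  linarith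

theorem norm_exp_modelPhase_le (θ : ℝ) :
    ‖Complex.exp (modelPhase Λ s (vert (a / Λ) θ))‖ ≤
      Real.exp (d + 2 * K) * Real.exp (-(Λ ^ 2 * a / (20 * K) * θ ^ 2)) := by
  rw [Complex.norm_exp, ← Real.exp_add, Real.exp_le_exp, re_modelPhase, h.Λ_mul_c, h.g_eq]
  have h1 : a ^ 3 ≤ 1 := pow_le_one₀ h.a_pos.le h.a_le_one
  have h2 : -(s * a) ≤ |s| * a := by nlinarith [neg_le_abs s, h.a_pos]
  have h3 : Λ ^ 2 * a / (20 * K) ≤ Λ ^ 2 * a :=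
    div_le_self h.g_pos.le (by linarith [h.one_le_K])
  have h4 : Λ ^ 2 * a / (20 * K) * θ ^ 2 ≤ Λ ^ 2 * a * θ ^ 2 := by gcongr
  have h5 : (0 : ℝ) ≤ d := Nat.cast_nonneg d
  linarith [h.s_le, h.one_le_K]

end Admissible

end WignerContour

/-! ### Pointwise comparison of the phases. -/

namespace WignerContour

open MeasureTheory

theorem half_le_norm_cosh {c θ : ℝ} (hθ : |θ| ≤ 1) : 1 / 2 ≤ ‖Complex.cosh (vert c θ)‖ := by
  have h1 := normSq_cosh c θ
  rw [Complex.normSq_eq_norm_sq] at h1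
  have h2 := Real.one_sub_sq_div_two_le_cos (x := θ)
  have h3 : θ ^ 2 ≤ 1 := by rw [← sq_abs]; nlinarith [abs_nonneg θ]
  have h4 := Real.sin_sq_add_cos_sq θ
  have h5 := Real.one_le_cosh c
  have h6 := norm_nonneg (Complex.cosh (vert c θ))
  rw [vert] at *
  by_contra hlt
  push Not at hlt
  nlinarith

theorem half_norm_le_norm_sinh {c θ : ℝ} (hc : 0 ≤ c) (hθ : |θ| ≤ Real.pi / 2) :
    ‖vert c θ‖ / 2 ≤ ‖Complex.sinh (vert c θ)‖ := by
  have h1 := normSq_sinh c θ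
  rw [Complex.normSq_eq_norm_sq] at h1
  have h2 := two_fifths_mul_sq_le_sin_sq hθ
  have h3 : c ≤ Real.sinh c := Real.self_le_sinh_iff.mpr hc
  have h4 := norm_vert_sq c θ
  refine le_of_sq_le_sq ?_ (norm_nonneg _)
  rw [← vert] at h1
  rw [h1, div_pow, h4]
  nlinarith [sq_nonneg θ, sq_nonneg c]

theorem le_pi_div_two_of_le_one {θ : ℝ} (hθ : |θ| ≤ 1) : |θ| ≤ Real.pi / 2 := by
  linarith [Real.pi_gt_three]

/-- Mean value inequality on the convex half-plane `Re z ≤ log M`. -/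
theorem norm_cexp_sub_cexp_le (A B : ℂ) {M : ℝ} (hA : ‖Complex.exp A‖ ≤ M)
    (hB : ‖Complex.exp B‖ ≤ M) : ‖Complex.exp A - Complex.exp B‖ ≤ M * ‖A - B‖ := by
  have hM : 0 < M := (norm_pos_iff.mpr (Complex.exp_ne_zero A)).trans_le hA
  rw [Complex.norm_exp, ← Real.le_log_iff_exp_le hM] at hA hB
  refine (convex_halfSpace_re_le (Real.log M)).norm_image_sub_le_of_norm_hasDerivWithin_le
    (f := Complex.exp) (f' := Complex.exp)
    (fun z _ => (Complex.hasDerivAt_exp z).hasDerivWithinAt) (fun z hz => ?_) hB hA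
  rw [Complex.norm_exp, ← Real.le_log_iff_exp_le hM]
  exact hz

theorem sq_le_exp_mul {b θ : ℝ} (hb : 0 < b) : θ ^ 2 ≤ 2 / b * Real.exp (b / 2 * θ ^ 2) := by
  have h := Real.add_one_le_exp (b / 2 * θ ^ 2)
  calc θ ^ 2 = 2 / b * (b / 2 * θ ^ 2) := by field_simp
    _ ≤ _ := by gcongr; linarith

theorem pow_four_le_exp_mul {b θ : ℝ} (hb : 0 < b) :
    θ ^ 4 ≤ 8 / b ^ 2 * Real.exp (b / 2 * θ ^ 2) := by
  have h := Real.quadratic_le_exp_of_nonneg (x := b / 2 * θ ^ 2) (by positivity)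
  have h2 : 0 ≤ b / 2 * θ ^ 2 := by positivity
  calc θ ^ 4 = 8 / b ^ 2 * ((b / 2 * θ ^ 2) ^ 2 / 2) := by field_simp; norm_num
    _ ≤ _ := by gcongr; linarith

/-- The amplitude of the contour integral. -/
noncomputable def amplitude (d : ℕ) (w : ℂ) : ℂ := (Complex.cosh w ^ d * Complex.sinh w)⁻¹

namespace Admissible

variable {d : ℕ} {K Λ a s m : ℝ} (h : Admissible d K Λ a s m)

include h

theorem norm_vert_pos (θ : ℝ) : 0 < ‖vert (a / Λ) θ‖ := by
  have h1 := norm_vert_sq (a / Λ) θ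
  have h2 : 0 < (a / Λ) ^ 2 := pow_pos h.c_pos 2
  by_contra hneg
  have : ‖vert (a / Λ) θ‖ = 0 := le_antisymm (not_lt.mp hneg) (norm_nonneg _)
  rw [this] at h1
  nlinarith [sq_nonneg θ]

theorem norm_vert_le_two {θ : ℝ} (hθ : |θ| ≤ 1) : ‖vert (a / Λ) θ‖ ≤ 2 := by
  have h1 := norm_vert_sq (a / Λ) θ
  have h2 : θ ^ 2 ≤ 1 := by rw [← sq_abs]; nlinarith [abs_nonneg θ]
  have h3 : (a / Λ) ^ 2 ≤ 1 := pow_le_one₀ h.c_pos.le h.c_le_one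
  nlinarith [norm_nonneg (vert (a / Λ) θ)]

/-- One factor `‖w‖` is split off in the bound because it will cancel the pole `1/w` of the
amplitude. -/
theorem norm_phase_sub_le {θ : ℝ} (hθ : |θ| ≤ 1) :
    ‖oscPhase m (Λ ^ 3 + s * Λ) (vert (a / Λ) θ) - modelPhase Λ s (vert (a / Λ) θ)‖ ≤
      (d + 100 * Λ ^ 3 * ‖vert (a / Λ) θ‖ ^ 4 + 401 * (|s| * Λ) * ‖vert (a / Λ) θ‖ ^ 2) *
        ‖vert (a / Λ) θ‖ := by
  have h2 := h.norm_vert_le_two hθ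
  have hC := half_le_norm_cosh (c := a / Λ) hθ
  set w := vert (a / Λ) θ
  have t3 := norm_tanh_sub_le h2 hC
  have t5 := norm_tanh_sub_taylor_le h2 hC
  have e : oscPhase m (Λ ^ 3 + s * Λ) w - modelPhase Λ s w =
      ((m - Λ ^ 3 : ℝ) : ℂ) * w - ((Λ ^ 3 : ℝ) : ℂ) * (Complex.tanh w - w + w ^ 3 / 3) -
        ((s * Λ : ℝ) : ℂ) * (Complex.tanh w - w) := by
    rw [oscPhase, modelPhase]
    push_cast
    ring
  rw [e]
  refine (norm_sub_le _ _).trans ((add_le_add_left (norm_sub_le _ _) _).trans ?_)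
  rw [norm_mul, norm_mul, norm_mul, Complex.norm_real, Complex.norm_real, Complex.norm_real,
    Real.norm_eq_abs, Real.norm_eq_abs, Real.norm_eq_abs, abs_mul s, abs_of_pos h.Λ_pos,
    abs_of_pos (pow_pos h.Λ_pos 3)]
  have hL := h.Λ_pos
  calc |m - Λ ^ 3| * ‖w‖ + Λ ^ 3 * ‖Complex.tanh w - w + w ^ 3 / 3‖ +
        |s| * Λ * ‖Complex.tanh w - w‖
      ≤ d * ‖w‖ + Λ ^ 3 * (100 * ‖w‖ ^ 5) + |s| * Λ * (401 * ‖w‖ ^ 3) := by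
        gcongr
        exact h.m_sub
    _ = _ := by ring

/-- Powers of `θ` are absorbed by half of the Gaussian, of rate `b` comparable to `Λ²a`. Both
`Λ³/b²` and `|s|Λ/b` are then `O(1/(Λa²))`, the second because `|s|a ≤ K`; powers of `c = a/Λ` cost
only constants. -/
theorem weight_le {θ : ℝ} :
    (d + 100 * Λ ^ 3 * ‖vert (a / Λ) θ‖ ^ 4 + 401 * (|s| * Λ) * ‖vert (a / Λ) θ‖ ^ 2) ≤
      (d + 1000 * K + 700000 * K ^ 2 / (Λ * a ^ 2)) *
        Real.exp (Λ ^ 2 * a / (20 * K) / 2 * θ ^ 2) := by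
  have hK := h.K_pos
  have hL := h.Λ_pos
  have ha := h.a_pos
  have hb : 0 < Λ ^ 2 * a / (20 * K) := div_pos h.g_pos (by linarith)
  have h2 := sq_le_exp_mul (θ := θ) hb
  have h4 := pow_four_le_exp_mul (θ := θ) hb
  set b := Λ ^ 2 * a / (20 * K) with hbdef
  have hX : 1 ≤ Real.exp (b / 2 * θ ^ 2) := Real.one_le_exp (by positivity)
  set X := Real.exp (b / 2 * θ ^ 2)
  have hn2 := norm_vert_sq (a / Λ) θ
  have hn4 : ‖vert (a / Λ) θ‖ ^ 4 ≤ 2 * (a / Λ) ^ 4 + 2 * θ ^ 4 := by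
    have : ‖vert (a / Λ) θ‖ ^ 4 = (‖vert (a / Λ) θ‖ ^ 2) ^ 2 := by ring
    rw [this, hn2]
    nlinarith [sq_nonneg ((a / Λ) ^ 2 - θ ^ 2)]
  have hΛc := h.Λ_mul_c
  have hc0 := h.c_pos
  have hc1 := h.c_le_one
  have f1 : Λ ^ 3 * (a / Λ) ^ 4 ≤ 1 := by
    have : Λ ^ 3 * (a / Λ) ^ 4 = (Λ * (a / Λ)) ^ 3 * (a / Λ) := by ring
    rw [this, hΛc]
    exact mul_le_one₀ (pow_le_one₀ ha.le h.a_le_one) hc0.le hc1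
  have f2 : |s| * Λ * (a / Λ) ^ 2 ≤ K := by
    have : |s| * Λ * (a / Λ) ^ 2 = |s| * (Λ * (a / Λ)) * (a / Λ) := by ring
    rw [this, hΛc]
    have := mul_le_mul h.s_le hc1 hc0.le hK.le
    linarith
  have f3 : Λ ^ 3 * (8 / b ^ 2) = 3200 * K ^ 2 / (Λ * a ^ 2) := by
    rw [hbdef]
    field_simp
    norm_num
  have f4 : |s| * Λ * (2 / b) ≤ 40 * K ^ 2 / (Λ * a ^ 2) := by
    have : |s| * Λ * (2 / b) = 40 * K * (|s| * a) / (Λ * a ^ 2) := by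
      rw [hbdef]
      field_simp
      ring
    rw [this]
    exact div_le_div_of_nonneg_right (by nlinarith [h.s_le]) (by positivity)
  set P := K ^ 2 / (Λ * a ^ 2) with hP
  have hP0 : 0 ≤ P := by positivity
  rw [mul_div_assoc, ← hP] at f3 f4 ⊢
  have g1 : Λ ^ 3 * ‖vert (a / Λ) θ‖ ^ 4 ≤ 2 + 6400 * P * X := by
    calc Λ ^ 3 * ‖vert (a / Λ) θ‖ ^ 4 ≤ Λ ^ 3 * (2 * (a / Λ) ^ 4 + 2 * (8 / b ^ 2 * X)) := by
          gcongr
          linarith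
      _ = 2 * (Λ ^ 3 * (a / Λ) ^ 4) + 2 * (Λ ^ 3 * (8 / b ^ 2)) * X := by ring
      _ ≤ _ := by rw [f3]; linarith
  have g2 : |s| * Λ * ‖vert (a / Λ) θ‖ ^ 2 ≤ K + 40 * P * X := by
    calc |s| * Λ * ‖vert (a / Λ) θ‖ ^ 2 ≤ |s| * Λ * ((a / Λ) ^ 2 + 2 / b * X) := by
          rw [hn2]; gcongr
      _ = |s| * Λ * (a / Λ) ^ 2 + |s| * Λ * (2 / b) * X := by ring
      _ ≤ _ := by gcongr
  have hK1 := h.one_le_K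
  have hd : (0 : ℝ) ≤ d := Nat.cast_nonneg d
  have g3 : (d + 200 + 401 * K) * 1 ≤ (d + 200 + 401 * K) * X := by gcongr
  have g4 : 0 ≤ P * X := by positivity
  have g5 : 200 * X ≤ 200 * K * X := by
    apply mul_le_mul_of_nonneg_right _ (by linarith); linarith
  have g7 : 0 ≤ K * X := by positivity
  calc _ = d + 100 * (Λ ^ 3 * ‖vert (a / Λ) θ‖ ^ 4) + 401 * (|s| * Λ * ‖vert (a / Λ) θ‖ ^ 2) := by
        ring
    _ ≤ d + 100 * (2 + 6400 * P * X) + 401 * (K + 40 * P * X) := by gcongr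
    _ ≤ _ := by
      nlinarith

end Admissible

end WignerContour

/-! ### Estimates on the inner and outer arcs, and integration. -/

namespace WignerContour

open MeasureTheory

namespace Admissible

variable {d : ℕ} {K Λ a s m : ℝ} (h : Admissible d K Λ a s m)

include h

theorem norm_sub_le_inner {k : ℝ} (hk : ∀ w : ℂ, ‖w‖ ≤ 2 → 1 / 2 ≤ ‖Complex.cosh w‖ →
      ‖w‖ / 2 ≤ ‖Complex.sinh w‖ → w ≠ 0 → ‖(Complex.cosh w ^ d * Complex.sinh w)⁻¹ - w⁻¹‖ ≤ k)
    (hk0 : 0 ≤ k) {θ : ℝ} (hθ : |θ| ≤ 1) :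
    ‖Complex.exp (oscPhase m (Λ ^ 3 + s * Λ) (vert (a / Λ) θ)) * amplitude d (vert (a / Λ) θ) -
        Complex.exp (modelPhase Λ s (vert (a / Λ) θ)) / vert (a / Λ) θ‖ ≤
      Real.exp (d + 2 * K) * (k + (d + 1000 * K + 700000 * K ^ 2 / (Λ * a ^ 2))) *
        Real.exp (-(Λ ^ 2 * a / (20 * K) / 2) * θ ^ 2) := by
  have hθ2 := le_pi_div_two_of_le_one hθ
  have hA := h.norm_exp_oscPhase_le hθ2
  have hB := h.norm_exp_modelPhase_le θ
  have hw := h.norm_vert_pos θ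
  have hAB := norm_cexp_sub_cexp_le _ _ hA hB
  have hph := h.norm_phase_sub_le hθ
  have hwt := h.weight_le (θ := θ)
  have hG := hk _ (h.norm_vert_le_two hθ) (half_le_norm_cosh hθ)
    (half_norm_le_norm_sinh h.c_pos.le hθ2) (norm_pos_iff.mp hw)
  have hb : 0 < Λ ^ 2 * a / (20 * K) := div_pos h.g_pos (by linarith [h.K_pos])
  set b := Λ ^ 2 * a / (20 * K)
  set w := vert (a / Λ) θ
  set A := oscPhase m (Λ ^ 3 + s * Λ) w
  set B := modelPhase Λ s w
  set M := Real.exp (d + 2 * K)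
  have hM : 0 < M := Real.exp_pos _
  set V := d + 100 * Λ ^ 3 * ‖w‖ ^ 4 + 401 * (|s| * Λ) * ‖w‖ ^ 2
  set W := d + 1000 * K + 700000 * K ^ 2 / (Λ * a ^ 2)
  -- The amplitude error carries the full Gaussian; the phase error carries `‖w‖`, which cancels the
  -- division by `w`.
  have e : Complex.exp A * amplitude d w - Complex.exp B / w =
      Complex.exp A * ((Complex.cosh w ^ d * Complex.sinh w)⁻¹ - w⁻¹) +
        (Complex.exp A - Complex.exp B) / w := by
    rw [amplitude]; ring
  have h1 : Real.exp (-(b * θ ^ 2)) * Real.exp (b / 2 * θ ^ 2) = Real.exp (-(b / 2) * θ ^ 2) := by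
    rw [← Real.exp_add]; ring_nf
  have h2 : Real.exp (-(b * θ ^ 2)) ≤ Real.exp (-(b / 2) * θ ^ 2) := by
    rw [Real.exp_le_exp]; nlinarith [mul_nonneg hb.le (sq_nonneg θ)]
  rw [e]
  refine (norm_add_le _ _).trans ?_
  rw [norm_mul, norm_div]
  calc _ ≤ M * Real.exp (-(b * θ ^ 2)) * k + M * Real.exp (-(b * θ ^ 2)) * (V * ‖w‖) / ‖w‖ := by
        gcongr
        exact hAB.trans (by gcongr)
    _ = M * k * Real.exp (-(b * θ ^ 2)) + M * Real.exp (-(b * θ ^ 2)) * V := by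
        field_simp
    _ ≤ M * k * Real.exp (-(b / 2) * θ ^ 2) +
        M * Real.exp (-(b * θ ^ 2)) * (W * Real.exp (b / 2 * θ ^ 2)) := by gcongr
    _ = M * k * Real.exp (-(b / 2) * θ ^ 2) +
        M * W * (Real.exp (-(b * θ ^ 2)) * Real.exp (b / 2 * θ ^ 2)) := by ring
    _ = _ := by rw [h1]; ring

/-- Since `g = Λ²a` is bounded below by `1/K`, any power `g^{-d}` with `d ≥ 1` is `O(g^{-1/2})`, the
size of the Gaussian integral on the inner arc. -/
theorem inv_g_pow_le (hd : 1 ≤ d) :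
    (5 * K / (Λ ^ 2 * a)) ^ d ≤ (5 * K ^ 2) ^ d / Real.sqrt (Λ ^ 2 * a) := by
  have hg := h.g_pos
  have hK := h.one_le_K
  have h1 := h.one_le_g
  set g := Λ ^ 2 * a
  have hs : 0 < Real.sqrt g := Real.sqrt_pos.mpr hg
  have hsg : Real.sqrt g * Real.sqrt g = g := Real.mul_self_sqrt hg.le
  have h2 : 1 / g ≤ K := by rw [div_le_iff₀ hg]; linarith
  have h3 : 1 / g ≤ K / Real.sqrt g := by
    rw [div_le_div_iff₀ hg hs, one_mul]
    have : 1 ≤ K * Real.sqrt g := by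
      by_contra hlt
      push Not at hlt
      have h5 : (K * Real.sqrt g) * (K * Real.sqrt g) < 1 := by
        nlinarith [mul_pos (by linarith : 0 < K) hs]
      nlinarith
    nlinarith
  obtain ⟨n, rfl⟩ : ∃ n, d = n + 1 := ⟨d - 1, by omega⟩
  calc (5 * K / g) ^ (n + 1) = (5 * K) ^ (n + 1) * ((1 / g) ^ n * (1 / g)) := by
        rw [← pow_succ, ← mul_pow]; ring
    _ ≤ (5 * K) ^ (n + 1) * (K ^ n * (K / Real.sqrt g)) := by gcongr
    _ = _ := by
      rw [mul_pow 5 (K ^ 2), mul_pow 5 K, pow_succ K n]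
      ring

/-- With `ρ = |cosh w|`, possibly tiny near `θ = ±π/2`, the exponential contributes `e^{-X/ρ²} ≤ d!
(ρ²/X)^d`. Against the amplitude `ρ^{-d}` this leaves `ρ^d X^{-d}`, which is harmless since `ρ ≤ 2`.
-/
theorem norm_le_outer (hd : 1 ≤ d) {θ : ℝ} (hθ1 : 1 ≤ |θ|) (hθ : |θ| ≤ Real.pi / 2) :
    ‖Complex.exp (oscPhase m (Λ ^ 3 + s * Λ) (vert (a / Λ) θ)) * amplitude d (vert (a / Λ) θ)‖ ≤
      2 * Real.exp (d + 2 * K) * d.factorial * (10 * K ^ 2) ^ d / Real.sqrt (Λ ^ 2 * a) := by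
  have hre := h.re_oscPhase_le θ
  have hρ := h.ρ_pos θ
  have hsin : 2 / 5 ≤ Real.sin θ ^ 2 := by
    have h1 := two_fifths_mul_sq_le_sin_sq hθ
    have h2 : 1 ≤ θ ^ 2 := by rw [← sq_abs]; nlinarith
    linarith
  have hcs := normSq_cosh (a / Λ) θ
  rw [← vert, Complex.normSq_eq_norm_sq] at hcs
  have hch := cosh_sq_le_three (c := a / Λ) (by rw [abs_of_pos h.c_pos]; exact h.c_le_one)
  have hS : 1 / 2 ≤ ‖Complex.sinh (vert (a / Λ) θ)‖ := by
    refine le_trans ?_ (half_norm_le_norm_sinh h.c_pos.le hθ)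
    have h1 := norm_vert_sq (a / Λ) θ
    have h2 : 1 ≤ θ ^ 2 := by rw [← sq_abs]; nlinarith
    nlinarith [sq_nonneg (a / Λ), norm_nonneg (vert (a / Λ) θ)]
  have hμc : 0 < (Λ ^ 3 + s * Λ) * (a / Λ) := mul_pos h.μ_pos h.c_pos
  have hgc := h.g_le_μc
  have hinv := h.inv_g_pow_le hd
  have hK := h.K_pos
  have hg := h.g_pos
  rw [norm_mul, amplitude, norm_inv, norm_mul, norm_pow, Complex.norm_exp]
  set ρ := ‖Complex.cosh (vert (a / Λ) θ)‖
  rw [← hcs] at hre hρ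
  have hρ0 : 0 < ρ := by
    rcases (norm_nonneg (Complex.cosh (vert (a / Λ) θ))).lt_or_eq with h0 | h0
    · exact h0
    · exfalso
      have : ρ = 0 := h0.symm
      rw [this] at hρ
      norm_num at hρ
  have hρ2 : ρ ≤ 2 := by nlinarith [sq_nonneg (Real.sin θ)]
  set X := (Λ ^ 3 + s * Λ) * (a / Λ) / 5 with hX
  have hX0 : 0 < X := by positivity
  have h1 : (oscPhase m (Λ ^ 3 + s * Λ) (vert (a / Λ) θ)).re ≤ d + 2 * K + -(X / ρ ^ 2) := by
    refine hre.trans ?_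
    have h2 : (Λ ^ 3 + s * Λ) * (a / Λ) / 2 * (2 / 5 / ρ ^ 2) ≤
        (Λ ^ 3 + s * Λ) * (a / Λ) / 2 * (Real.sin θ ^ 2 / ρ ^ 2) := by gcongr
    have h3 : (Λ ^ 3 + s * Λ) * (a / Λ) / 2 * (2 / 5 / ρ ^ 2) = X / ρ ^ 2 := by rw [hX]; ring
    linarith
  have h2 : Real.exp (-(X / ρ ^ 2)) ≤ d.factorial * (ρ ^ 2 / X) ^ d := by
    have h3 := Real.pow_div_factorial_le_exp (x := X / ρ ^ 2) (by positivity) d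
    rw [Real.exp_neg, inv_le_comm₀ (Real.exp_pos _) (by positivity)]
    refine le_trans (le_of_eq ?_) h3
    rw [mul_inv, ← inv_pow, inv_div]
    ring
  have h4 : 1 / X ≤ 5 * K / (Λ ^ 2 * a) := by
    rw [div_le_div_iff₀ hX0 hg, hX]
    linarith
  clear_value X
  calc _ ≤ Real.exp (d + 2 * K) * (d.factorial * (ρ ^ 2 / X) ^ d) * (ρ ^ d * (1 / 2))⁻¹ := by
        have h5 := Real.exp_le_exp.mpr h1
        rw [Real.exp_add] at h5
        have h6 : Real.exp (d + 2 * K) * Real.exp (-(X / ρ ^ 2)) ≤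
          Real.exp (d + 2 * K) * (d.factorial * (ρ ^ 2 / X) ^ d) := by gcongr
        exact mul_le_mul (h5.trans h6) (by gcongr) (by positivity) (by positivity)
    _ = 2 * Real.exp (d + 2 * K) * d.factorial * (ρ ^ d * (1 / X) ^ d) := by
        rw [div_pow, div_pow]
        field_simp
        ring
    _ ≤ 2 * Real.exp (d + 2 * K) * d.factorial *
        (2 ^ d * ((5 * K ^ 2) ^ d / Real.sqrt (Λ ^ 2 * a))) := by
        gcongr
        exact le_trans (by gcongr) hinv
    _ = _ := by
        rw [show (10 * K ^ 2) ^ d = 2 ^ d * (5 * K ^ 2) ^ d by rw [← mul_pow]; ring_nf]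
        ring

theorem norm_model_le {θ : ℝ} (hθ1 : 1 ≤ |θ|) :
    ‖Complex.exp (modelPhase Λ s (vert (a / Λ) θ)) / vert (a / Λ) θ‖ ≤
      Real.exp (d + 2 * K) * Real.exp (-(Λ ^ 2 * a / (20 * K) / 2) * θ ^ 2) := by
  have hB := h.norm_exp_modelPhase_le θ
  have h1 := norm_vert_sq (a / Λ) θ
  have h2 : 1 ≤ θ ^ 2 := by rw [← sq_abs]; nlinarith
  have h3 : 1 ≤ ‖vert (a / Λ) θ‖ := by
    nlinarith [sq_nonneg (a / Λ), norm_nonneg (vert (a / Λ) θ)]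
  rw [norm_div]
  refine (div_le_self (norm_nonneg _) h3).trans (hB.trans ?_)
  have hb : 0 < Λ ^ 2 * a / (20 * K) := div_pos h.g_pos (by linarith [h.K_pos])
  gcongr
  nlinarith [mul_nonneg hb.le (sq_nonneg θ)]

theorem continuous_model : Continuous fun θ : ℝ =>
    Complex.exp (modelPhase Λ s (vert (a / Λ) θ)) / vert (a / Λ) θ := by
  refine Continuous.div ?_ (by unfold vert; fun_prop) fun θ => norm_pos_iff.mp (h.norm_vert_pos θ)
  unfold modelPhase vert
  fun_prop

theorem integrable_model : Integrable fun θ : ℝ =>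
    Complex.exp (modelPhase Λ s (vert (a / Λ) θ)) / vert (a / Λ) θ := by
  have hb : 0 < Λ ^ 2 * a / (20 * K) := div_pos h.g_pos (by linarith [h.K_pos])
  refine ((integrable_exp_neg_mul_sq hb).const_mul (Real.exp (d + 2 * K) / (a / Λ))).mono'
    h.continuous_model.aestronglyMeasurable (.of_forall fun θ => ?_)
  have hc := h.c_pos
  have h1 : a / Λ ≤ ‖vert (a / Λ) θ‖ := by
    have := Complex.abs_re_le_norm (vert (a / Λ) θ)
    rwa [vert_re, abs_of_pos hc] at this
  rw [norm_div, div_mul_eq_mul_div]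
  have hB := h.norm_exp_modelPhase_le θ
  rw [← neg_mul] at hB
  gcongr

theorem continuous_osc : Continuous fun θ : ℝ =>
    Complex.exp (oscPhase m (Λ ^ 3 + s * Λ) (vert (a / Λ) θ)) * amplitude d (vert (a / Λ) θ) := by
  have hC (θ : ℝ) : Complex.cosh (vert (a / Λ) θ) ≠ 0 := by
    rw [← Complex.normSq_pos, vert, normSq_cosh]
    exact h.ρ_pos θ
  have hS (θ : ℝ) : Complex.sinh (vert (a / Λ) θ) ≠ 0 := by
    rw [← Complex.normSq_pos, vert, normSq_sinh]
    have : 0 < Real.sinh (a / Λ) := Real.sinh_pos_iff.mpr h.c_pos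
    positivity
  have hv : Continuous (vert (a / Λ)) := by unfold vert; fun_prop
  have hcosh := Complex.continuous_cosh.comp hv
  have hsinh := Complex.continuous_sinh.comp hv
  refine Continuous.mul (Complex.continuous_exp.comp ?_) ?_
  · unfold oscPhase
    refine (continuous_const.mul hv).sub (continuous_const.mul ?_)
    simp only [Complex.tanh_eq_sinh_div_cosh]
    exact hsinh.div hcosh hC
  · unfold amplitude
    exact ((hcosh.pow d).mul hsinh).inv₀ fun θ => mul_ne_zero (pow_ne_zero _ (hC θ)) (hS θ)

end Admissible

/-- The contour integral of the bulk Wigner distribution differs from its Airy model by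
`O((1 + Λ⁻¹ a⁻²) Λ⁻¹ a^{-1/2})`. -/
theorem exists_norm_integral_sub_le {d : ℕ} (hd : 1 ≤ d) {K : ℝ} (hK : 1 ≤ K) : ∃ C : ℝ, 0 ≤ C ∧
    ∀ Λ a s m : ℝ, Admissible d K Λ a s m →
      ‖(∫ θ in (-(Real.pi / 2))..(Real.pi / 2),
          Complex.exp (oscPhase m (Λ ^ 3 + s * Λ) (vert (a / Λ) θ)) *
            amplitude d (vert (a / Λ) θ)) -
        ∫ θ : ℝ, Complex.exp (modelPhase Λ s (vert (a / Λ) θ)) / vert (a / Λ) θ‖ ≤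
      C * (1 + 1 / (Λ * a ^ 2)) / Real.sqrt (Λ ^ 2 * a) := by
  obtain ⟨k, hk0, hk⟩ := exists_amplitude_bound d
  set M := Real.exp (d + 2 * K) with hM
  have hM0 : 0 < M := Real.exp_pos _
  set O := 2 * M * d.factorial * (10 * K ^ 2) ^ d with hO
  have hO0 : 0 ≤ O := by positivity
  refine ⟨M * (1 + k + d + 1000 * K + 700000 * K ^ 2) * Real.sqrt (40 * K * Real.pi) +
    Real.pi * O, by positivity, fun Λ a s m h => ?_⟩
  have hg := h.g_pos
  have hL := h.Λ_pos
  have ha := h.a_pos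
  have hb : 0 < Λ ^ 2 * a / (20 * K) / 2 := by positivity
  set I : Set ℝ := Set.Ioc (-(Real.pi / 2)) (Real.pi / 2)
  have hpi := Real.pi_gt_three
  set W := d + 1000 * K + 700000 * K ^ 2 / (Λ * a ^ 2) with hW
  have hW0 : 0 ≤ W := by positivity
  set f : ℝ → ℂ := fun θ => Complex.exp (oscPhase m (Λ ^ 3 + s * Λ) (vert (a / Λ) θ)) *
            amplitude d (vert (a / Λ) θ) with hf
  set p : ℝ → ℂ := fun θ => Complex.exp (modelPhase Λ s (vert (a / Λ) θ)) / vert (a / Λ) θ with hp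
  have hfint : Integrable (I.indicator f) :=
    (integrable_indicator_iff measurableSet_Ioc).mpr
      (h.continuous_osc.integrableOn_Icc.mono_set Set.Ioc_subset_Icc_self)
  -- Extending `f` by zero lets one pointwise bound cover the inner arc, the outer arc and the tails
  -- of the model beyond `|θ| = π/2`.
  have hsplit : (∫ θ in (-(Real.pi / 2))..(Real.pi / 2), f θ) - ∫ θ, p θ =
      ∫ θ, (I.indicator f θ - p θ) := by
    rw [integral_sub hfint h.integrable_model, integral_indicator measurableSet_Ioc,
      intervalIntegral.integral_of_le (by linarith)]
  rw [hsplit]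
  have hpt (θ : ℝ) : ‖I.indicator f θ - p θ‖ ≤
      M * (1 + k + W) * Real.exp (-(Λ ^ 2 * a / (20 * K) / 2) * θ ^ 2) +
        I.indicator (fun _ => O / Real.sqrt (Λ ^ 2 * a)) θ := by
    have hE := Real.exp_pos (-(Λ ^ 2 * a / (20 * K) / 2) * θ ^ 2)
    set e := Real.exp (-(Λ ^ 2 * a / (20 * K) / 2) * θ ^ 2)
    have hO1 : 0 ≤ O / Real.sqrt (Λ ^ 2 * a) := by positivity
    have hind : 0 ≤ I.indicator (fun _ => O / Real.sqrt (Λ ^ 2 * a)) θ :=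
      Set.indicator_nonneg (fun _ _ => hO1) θ
    have hMe : 0 ≤ M * e := by positivity
    have hkW : 0 ≤ M * (k + W) * e := by positivity
    by_cases h1 : |θ| ≤ 1
    · have hmem : θ ∈ I := by
        rw [abs_le] at h1
        exact ⟨by linarith, by linarith⟩
      rw [Set.indicator_of_mem hmem f]
      refine (h.norm_sub_le_inner hk hk0 h1).trans ?_
      linarith
    · have h1 : 1 ≤ |θ| := (not_le.mp h1).le
      have hm := h.norm_model_le h1
      refine (norm_sub_le _ _).trans ?_
      by_cases hmem : θ ∈ I
      · rw [Set.indicator_of_mem hmem, Set.indicator_of_mem hmem]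
        have := h.norm_le_outer hd h1 (abs_le.mpr ⟨hmem.1.le, hmem.2⟩)
        linarith
      · rw [Set.indicator_of_notMem hmem, Set.indicator_of_notMem hmem, norm_zero]
        linarith
  have hi1 : Integrable fun θ : ℝ =>
      M * (1 + k + W) * Real.exp (-(Λ ^ 2 * a / (20 * K) / 2) * θ ^ 2) :=
    (integrable_exp_neg_mul_sq hb).const_mul _
  have hi2 : Integrable (I.indicator fun _ => O / Real.sqrt (Λ ^ 2 * a)) :=
    (integrable_indicator_iff measurableSet_Ioc).mpr (integrableOn_const (by simp))
  refine (norm_integral_le_of_norm_le (hi1.add hi2) (.of_forall hpt)).trans ?_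
  rw [integral_add' hi1 hi2, integral_const_mul, integral_gaussian,
    integral_indicator measurableSet_Ioc, setIntegral_const]
  have hvol : volume.real I = Real.pi := by
    rw [Real.volume_real_Ioc_of_le (by linarith)]
    ring
  have hsq : Real.sqrt (Real.pi / (Λ ^ 2 * a / (20 * K) / 2)) =
      Real.sqrt (40 * K * Real.pi) / Real.sqrt (Λ ^ 2 * a) := by
    rw [← Real.sqrt_div (by positivity)]
    congr 1
    field_simp
    norm_num
  rw [hvol, hsq, smul_eq_mul]
  have hP : 0 ≤ 1 / (Λ * a ^ 2) := by positivity
  set P := 1 / (Λ * a ^ 2) with hPdef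
  have hWP : 1 + k + W ≤ (1 + k + d + 1000 * K + 700000 * K ^ 2) * (1 + P) := by
    have : 700000 * K ^ 2 / (Λ * a ^ 2) = 700000 * K ^ 2 * P := by rw [hPdef]; ring
    rw [hW, this]
    have h1 : 0 ≤ (1 + k + d + 1000 * K) * P := by positivity
    have h2 : 0 ≤ 700000 * K ^ 2 := by positivity
    linarith
  have hOP : Real.pi * O ≤ Real.pi * O * (1 + P) :=
    le_mul_of_one_le_right (by positivity) (by linarith)
  calc _ = (M * (1 + k + W) * Real.sqrt (40 * K * Real.pi) + Real.pi * O) /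
        Real.sqrt (Λ ^ 2 * a) := by ring
    _ ≤ (M * ((1 + k + d + 1000 * K + 700000 * K ^ 2) * (1 + P)) * Real.sqrt (40 * K * Real.pi) +
        Real.pi * O * (1 + P)) / Real.sqrt (Λ ^ 2 * a) := by gcongr
    _ = _ := by ring

end WignerContour

/-! ### Substitution of the parameters of the theorem. -/

namespace WignerContour

open MeasureTheory

/-- The Airy primitive along the rescaled vertical contour. -/
theorem integral_airyAi_eq_model (s : ℝ) {Λ a : ℝ} (hΛ : 0 < Λ) (ha : 0 < a) :
    ∫ τ in Set.Ioi (0 : ℝ), airyAi (s + τ) = (2 * Real.pi)⁻¹ *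
      (∫ θ : ℝ, Complex.exp (modelPhase Λ s (vert (a / Λ) θ)) / vert (a / Λ) θ).re := by
  rw [AiryContour.integral_airyAi s ha]
  have hsub := Measure.integral_comp_mul_left
    (fun y : ℝ => AiryContour.airyPhase s (a + y * Complex.I) / (a + y * Complex.I)) Λ
  rw [abs_of_pos (inv_pos.mpr hΛ), eq_comm, inv_smul_eq_iff₀ hΛ.ne'] at hsub
  rw [hsub, ← integral_smul]
  congr 3
  ext θ
  have hΛ0 : (Λ : ℂ) ≠ 0 := by exact_mod_cast hΛ.ne'
  have e : (a : ℂ) + ((Λ * θ : ℝ) : ℂ) * Complex.I = Λ * vert (a / Λ) θ := by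
    rw [vert]
    push_cast
    field_simp
  rw [e, AiryContour.airyPhase, modelPhase, Complex.real_smul, ← mul_div_assoc,
    mul_div_mul_left _ _ hΛ0]

theorem oscEnergy_le_iff {d : ℕ} {ħ E : ℝ} (hħ : 0 < ħ) (N : ℕ) :
    oscEnergy d ħ N ≤ E ↔ N < ⌊E / ħ - d / 2 + 1⌋₊ := by
  rw [← Nat.succ_le_iff, Nat.le_floor_iff' (Nat.succ_ne_zero N), oscEnergy, mul_comm,
    ← le_div_iff₀ hħ]
  push_cast
  constructor <;> intro h <;> linarith

/-- Here `y = 2E/ħ = Λ³`. Rounding costs at most 1. If the argument of the floor is negative, no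
eigenvalue is counted and `0 < y < d - 2`, so the error is still at most `d`. -/
theorem abs_two_mul_floor_sub_le {d : ℕ} (hd : 1 ≤ d) {y : ℝ} (hy : 0 < y) :
    |2 * (⌊y / 2 - d / 2 + 1⌋₊ : ℝ) + d - 1 - y| ≤ d := by
  have hd' : (1 : ℝ) ≤ d := by exact_mod_cast hd
  rw [abs_le]
  rcases le_or_gt 0 (y / 2 - d / 2 + 1) with h | h
  · have h1 := Nat.floor_le h
    have h2 := Nat.lt_floor_add_one (y / 2 - d / 2 + 1)
    constructor <;> linarith
  · rw [Nat.floor_of_nonpos h.le]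
    push_cast
    constructor <;> linarith

theorem sq_mul_sqrt_one_add_le {v : ℝ} (hv : 0 ≤ v) :
    (1 + v) ^ 2 * Real.sqrt (1 + v) ≤ 8 * (1 + v ^ (5 / 2 : ℝ)) := by
  have h2 : Real.sqrt 2 ≤ 2 := by rw [Real.sqrt_le_left (by norm_num)]; norm_num
  have h0 : 0 ≤ v ^ (5 / 2 : ℝ) := by positivity
  rcases le_total v 1 with h | h
  · have h3 : Real.sqrt (1 + v) ≤ Real.sqrt 2 := Real.sqrt_le_sqrt (by linarith)
    have h4 : (1 + v) ^ 2 ≤ 4 := by nlinarith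
    have h5 : (1 + v) ^ 2 * Real.sqrt (1 + v) ≤ 4 * 2 :=
      mul_le_mul h4 (h3.trans h2) (Real.sqrt_nonneg _) (by norm_num)
    linarith
  · have h3 : Real.sqrt (1 + v) ≤ 2 * Real.sqrt v := by
      calc Real.sqrt (1 + v) ≤ Real.sqrt (2 * v) := Real.sqrt_le_sqrt (by linarith)
        _ = Real.sqrt 2 * Real.sqrt v := Real.sqrt_mul (by norm_num) v
        _ ≤ _ := by gcongr
    have h4 : (1 + v) ^ 2 ≤ 4 * v ^ 2 := by nlinarith
    have h5 : v ^ (5 / 2 : ℝ) = v ^ 2 * Real.sqrt v := by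
      rw [Real.sqrt_eq_rpow, ← Real.rpow_natCast, ← Real.rpow_add (by linarith)]
      norm_num
    calc (1 + v) ^ 2 * Real.sqrt (1 + v) ≤ 4 * v ^ 2 * (2 * Real.sqrt v) :=
          mul_le_mul h4 h3 (Real.sqrt_nonneg _) (by positivity)
      _ = 8 * v ^ (5 / 2 : ℝ) := by rw [h5]; ring
      _ ≤ _ := by linarith

/-- The parameters of the theorem are admissible, with a constant depending only on `δ`
(through `κ = (2δ)^{1/3}`) and the choice of `η`. -/
theorem admissible_of_scaling {d : ℕ} (hd : 1 ≤ d) {δ κ η E ħ t u Λ H : ℝ} (hδ : 0 < δ)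
    (hκ : 0 < κ) (hκ3 : κ ^ 3 = 2 * δ) (hη : 0 < η) (hη1 : η ≤ 1) (hηκ : η ≤ κ) (hE : δ ≤ E)
    (ht : 0 < t) (ht1 : t ≤ 1) (hħ : ħ = t ^ 3) (hu : |u| * t ^ 2 ≤ 1) (hΛ : 0 < Λ)
    (hΛ3 : Λ ^ 3 = 2 * E / ħ) (hHE : H - E = u / Λ ^ 2) (hH : δ ≤ H) :
    κ / t ≤ Λ ∧ 2 * H / ħ = Λ ^ 3 + u / E * Λ ∧
    Admissible d (1 + 1 / δ + 1 / (κ ^ 2 * δ) + 2 / (κ ^ 2 * η)) Λ (η / (1 + |u|)) (u / E)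
      (2 * (⌊E / ħ - d / 2 + 1⌋₊ : ℝ) + d - 1) := by
  have hħ0 : 0 < ħ := hħ ▸ pow_pos ht 3
  have hE0 : 0 < E := hδ.trans_le hE
  have hH0 : 0 ≤ H := hδ.le.trans hH
  have hU : 0 < 1 + |u| := by positivity
  have hκΛ : κ / t ≤ Λ := by
    refine le_of_pow_le_pow_left₀ (n := 3) (by norm_num) hΛ.le ?_
    rw [div_pow, hκ3, hΛ3, ← hħ]
    gcongr
  have hκΛ1 : κ ≤ Λ := (by rw [le_div_iff₀ ht]; nlinarith : κ ≤ κ / t).trans hκΛ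
  have hμ : 2 * H / ħ = Λ ^ 3 + u / E * Λ := by
    have h1 : H = E + u / Λ ^ 2 := by linarith
    have h2 : 2 * E = Λ ^ 3 * ħ := by rw [hΛ3]; field_simp
    have h3 : u / E * Λ = 2 * u / (Λ ^ 2 * ħ) := by
      rw [div_mul_eq_mul_div, div_eq_div_iff hE0.ne' (by positivity)]
      linear_combination -u * h2
    rw [h3, hΛ3, h1]
    field_simp
  have hκt : κ ^ 2 / t ^ 2 ≤ Λ ^ 2 := by
    rw [← div_pow]; gcongr
  have huΛ : |u| / Λ ^ 2 ≤ 1 / κ ^ 2 := by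
    rw [div_le_div_iff₀ (by positivity) (by positivity)]
    rw [div_le_iff₀ (by positivity)] at hκt
    calc |u| * κ ^ 2 ≤ |u| * (Λ ^ 2 * t ^ 2) := by gcongr
      _ = |u| * t ^ 2 * Λ ^ 2 := by ring
      _ ≤ 1 * Λ ^ 2 := by gcongr
  -- The bound `κ⁻²` is written as a multiple of `δ`, since `E, H ≥ δ` then makes `E` and `H`
  -- comparable.
  have hdiff : |H - E| ≤ 1 / (κ ^ 2 * δ) * δ := by
    rw [hHE, abs_div, abs_of_pos (pow_pos hΛ 2)]
    refine huΛ.trans (le_of_eq ?_)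
    field_simp
  obtain ⟨hd1, hd2⟩ := abs_le.mp hdiff
  have k1 : 0 < 1 / δ := by positivity
  have k2 : 0 < 1 / (κ ^ 2 * δ) := by positivity
  have k3 : 0 < 2 / (κ ^ 2 * η) := by positivity
  -- Here `1/δ` serves `|s|a ≤ K`, `1 + 1/(κ²δ)` the comparison of `E` with `H` both ways, and
  -- `2/(κ²η)` the lower bound on `Λ²a`.
  set K := 1 + 1 / δ + 1 / (κ ^ 2 * δ) + 2 / (κ ^ 2 * η) with hK
  have hK1 : 1 + 1 / (κ ^ 2 * δ) ≤ K := by linarith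
  have hK0 : 0 < K := by linarith
  have ha : η / (1 + |u|) ≤ η := div_le_self hη.le (by linarith [abs_nonneg u])
  refine ⟨hκΛ, hμ, ⟨by linarith, hΛ, by positivity, ha.trans hη1, (ha.trans hηκ).trans hκΛ1,
    ?_, ?_, ?_, ?_, ?_⟩⟩
  · rw [abs_div, abs_of_pos hE0]
    have h1 : |u| / E * (η / (1 + |u|)) = (|u| / (1 + |u|)) * (η / E) := by ring
    have h2 : |u| / (1 + |u|) ≤ 1 := (div_le_one hU).mpr (by linarith)
    have h3 : η / E ≤ 1 / δ := div_le_div₀ zero_le_one hη1 hδ hE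
    have h4 : |u| / (1 + |u|) * (η / E) ≤ 1 * (1 / δ) :=
      mul_le_mul h2 h3 (by positivity) zero_le_one
    linarith
  · rw [← hμ, hΛ3, ← mul_div_assoc]
    gcongr ?_ / ħ
    have h1 : 1 / (κ ^ 2 * δ) * δ ≤ 1 / (κ ^ 2 * δ) * H := by gcongr
    have h2 : (1 + 1 / (κ ^ 2 * δ)) * H ≤ K * H := by gcongr
    linarith
  · rw [← hμ, hΛ3, ← mul_div_assoc]
    gcongr ?_ / ħ
    have h1 : 1 / (κ ^ 2 * δ) * δ ≤ 1 / (κ ^ 2 * δ) * E := by gcongr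
    have h2 : (1 + 1 / (κ ^ 2 * δ)) * E ≤ K * E := by gcongr
    linarith
  · have h1 := abs_two_mul_floor_sub_le hd (y := 2 * E / ħ) (by positivity)
    rw [hΛ3]
    rwa [show 2 * E / ħ / 2 = E / ħ by ring] at h1
  · have h1 : (1 + |u|) * t ^ 2 ≤ 2 := by nlinarith [pow_le_one₀ (n := 2) ht.le ht1]
    have h2 : κ ^ 2 * η / 2 ≤ Λ ^ 2 * (η / (1 + |u|)) := by
      rw [div_le_iff₀ (by positivity)] at hκt
      rw [mul_div_assoc', div_le_div_iff₀ two_pos hU]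
      calc κ ^ 2 * η * (1 + |u|) ≤ Λ ^ 2 * t ^ 2 * η * (1 + |u|) := by gcongr
        _ = Λ ^ 2 * η * ((1 + |u|) * t ^ 2) := by ring
        _ ≤ Λ ^ 2 * η * 2 := by gcongr
    calc (1 : ℝ) = 2 / (κ ^ 2 * η) * (κ ^ 2 * η / 2) := by field_simp
      _ ≤ K * (Λ ^ 2 * (η / (1 + |u|))) := by
        gcongr
        linarith

/-- With `a = η/(1+|u|)` and `1/Λ ≤ t/κ`, the term `1/(Λ√a)` is of order `t(1+|u|)^{1/2}`, and
`1/(Λ²a^{5/2})` is of order `t²(1+|u|)^{5/2}`, hence of order `t² + t²|u|^{5/2}`. The lone `t²` goes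
into the first term. -/
theorem error_le {κ η t u Λ : ℝ} (hκ : 0 < κ) (hη : 0 < η) (hη1 : η ≤ 1) (ht : 0 < t)
    (ht1 : t ≤ 1) (hΛ : 0 < Λ) (hκΛ : κ / t ≤ Λ) :
    (1 + 1 / (Λ * (η / (1 + |u|)) ^ 2)) / Real.sqrt (Λ ^ 2 * (η / (1 + |u|))) ≤
      (1 / (κ * η) + 8 / (κ ^ 2 * η ^ 3)) *
        (t * (1 + |u|) ^ (1 / 2 : ℝ) + |u| ^ (5 / 2 : ℝ) * t ^ 2) := by
  have hU1 : 1 ≤ 1 + |u| := by linarith [abs_nonneg u]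
  have hfive := sq_mul_sqrt_one_add_le (abs_nonneg u)
  rw [← Real.sqrt_eq_rpow]
  have hq : 0 ≤ |u| ^ (5 / 2 : ℝ) := by positivity
  set q := |u| ^ (5 / 2 : ℝ)
  set U := 1 + |u|
  have hU : 0 < U := by linarith
  set r := Real.sqrt U
  have hr1 : 1 ≤ r := Real.one_le_sqrt.mpr hU1
  have hη2 : η ≤ Real.sqrt η := Real.le_sqrt_of_sq_le (by nlinarith)
  have hsη : 0 < Real.sqrt η := Real.sqrt_pos.mpr hη
  have hr : 0 < r := by linarith
  have hinv : 1 / Λ ≤ t / κ := by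
    rw [div_le_div_iff₀ hΛ hκ]
    rw [div_le_iff₀ ht] at hκΛ
    linarith
  have hη3 : 1 / Real.sqrt η ≤ 1 / η := one_div_le_one_div_of_le hη hη2
  rw [Real.sqrt_mul (by positivity), Real.sqrt_sq hΛ.le, Real.sqrt_div hη.le]
  calc (1 + 1 / (Λ * (η / U) ^ 2)) / (Λ * (Real.sqrt η / r))
      = 1 / Λ * (1 / Real.sqrt η) * r +
        (1 / Λ) ^ 2 * (1 / η ^ 2) * (1 / Real.sqrt η) * (U ^ 2 * r) := by
        field_simp
    _ ≤ t / κ * (1 / η) * r + (t / κ) ^ 2 * (1 / η ^ 2) * (1 / η) * (8 * (1 + q)) := by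
        gcongr
    _ = 1 / (κ * η) * (t * r) + 8 / (κ ^ 2 * η ^ 3) * (t * t) +
        8 / (κ ^ 2 * η ^ 3) * (q * t ^ 2) := by
        field_simp
        ring
    _ ≤ 1 / (κ * η) * (t * r) + 8 / (κ ^ 2 * η ^ 3) * (t * r) +
        8 / (κ ^ 2 * η ^ 3) * (q * t ^ 2) := by
        gcongr
        linarith
    _ ≤ _ := by
        have : 0 ≤ 1 / (κ * η) * (q * t ^ 2) := by positivity
        linarith

end WignerContour

open WignerContour in
theorem mainTheorem9 (d : ℕ) (hd : 1 ≤ d) (ε δ : ℝ) (hε : 0 < ε) (hδ : 0 < δ) :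
    ∃ C : ℝ, ∀ (E ħ u : ℝ) (x ξ : EuclideanSpace ℝ (Fin d)),
      δ ≤ E → 0 < ħ → ħ ≤ 1 →
      |u| < ħ ^ (-(2 / 3 : ℝ)) →
      hamiltonian x ξ - E = u * (ħ / (2 * E)) ^ (2 / 3 : ℝ) →
      δ ≤ hamiltonian x ξ →
      ‖bulkWigner d ħ 0 E x ξ -
          ((((2 * Real.pi * ħ) ^ d)⁻¹ *
            ∫ τ in Set.Ioi (0 : ℝ), airyAi (u / E + τ) : ℝ) : ℂ)‖ ≤
        ((2 * Real.pi * ħ) ^ d)⁻¹ *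
          (C * (ħ ^ (1 / 3 - ε : ℝ) * (1 + |u|) ^ (1 / 2 : ℝ)) +
            C * (|u| ^ (5 / 2 : ℝ) * ħ ^ (2 / 3 - ε : ℝ))) := by
  set κ := (2 * δ) ^ (1 / 3 : ℝ) with hκdef
  have hκ : 0 < κ := by positivity
  have hκ3 : κ ^ 3 = 2 * δ := by
    rw [hκdef, ← Real.rpow_natCast, ← Real.rpow_mul (by positivity)]
    norm_num
  -- This makes `a ≤ 1`, and also `a ≤ κ ≤ Λ`, so that the contour height `a/Λ` is at most 1.
  set η := min 1 κ with hηdef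
  have hη : 0 < η := lt_min one_pos hκ
  have hK1 : 1 ≤ 1 + 1 / δ + 1 / (κ ^ 2 * δ) + 2 / (κ ^ 2 * η) := by
    have : 0 ≤ 1 / δ + 1 / (κ ^ 2 * δ) + 2 / (κ ^ 2 * η) := by positivity
    linarith
  obtain ⟨C₀, hC₀, hmain⟩ := exists_norm_integral_sub_le hd hK1
  refine ⟨C₀ * (1 / (κ * η) + 8 / (κ ^ 2 * η ^ 3)), fun E ħ u x ξ hE hħ hħ1 hu hHE hH => ?_⟩
  have hE0 : 0 < E := hδ.trans_le hE
  set t := ħ ^ (1 / 3 : ℝ) with htdef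
  have ht : 0 < t := by positivity
  have ht1 : t ≤ 1 := Real.rpow_le_one hħ.le hħ1 (by norm_num)
  have ht3 : ħ = t ^ 3 := by
    rw [htdef, ← Real.rpow_natCast, ← Real.rpow_mul hħ.le]
    norm_num
  have ht2 : t ^ 2 = ħ ^ (2 / 3 : ℝ) := by
    rw [htdef, ← Real.rpow_natCast, ← Real.rpow_mul hħ.le]
    norm_num
  have hut : |u| * t ^ 2 ≤ 1 := by
    rw [Real.rpow_neg hħ.le, ← ht2] at hu
    have := mul_le_mul_of_nonneg_right hu.le (by positivity : 0 ≤ t ^ 2)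
    rwa [inv_mul_cancel₀ (by positivity)] at this
  set Λ := (2 * E / ħ) ^ (1 / 3 : ℝ) with hΛdef
  have hΛ : 0 < Λ := by positivity
  have hΛ3 : Λ ^ 3 = 2 * E / ħ := by
    rw [hΛdef, ← Real.rpow_natCast, ← Real.rpow_mul (by positivity)]
    norm_num
  have hHE' : hamiltonian x ξ - E = u / Λ ^ 2 := by
    rw [hHE, ← inv_div (2 * E) ħ, Real.inv_rpow (by positivity), ← div_eq_mul_inv, hΛdef,
      ← Real.rpow_natCast, ← Real.rpow_mul (by positivity)]
    norm_num
  obtain ⟨hκΛ, hμ, hadm⟩ := admissible_of_scaling hd hδ hκ hκ3 hη (min_le_left 1 κ)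
    (min_le_right 1 κ) hE ht ht1 ht3 hut hΛ hΛ3 hHE' hH
  obtain ⟨S, hbulk, hS⟩ := WignerHermite.bulkWigner_eq hħ x ξ hadm.c_pos
    (oscEnergy_le_iff (d := d) (E := E) hħ)
  have hbound := hmain _ _ _ _ hadm
  have herr := error_le (u := u) hκ hη (min_le_left 1 κ) ht ht1 hΛ hκΛ
  have hai := integral_airyAi_eq_model (u / E) hΛ hadm.a_pos
  rw [hμ] at hS
  set a := η / (1 + |u|)
  set s := u / E
  set n := ⌊E / ħ - d / 2 + 1⌋₊
  set J := ∫ θ in (-(Real.pi / 2))..(Real.pi / 2),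
          Complex.exp (oscPhase (2 * n + d - 1) (Λ ^ 3 + s * Λ) (vert (a / Λ) θ)) *
            amplitude d (vert (a / Λ) θ) with hJ
  set J' := ∫ θ : ℝ, Complex.exp (modelPhase Λ s (vert (a / Λ) θ)) / vert (a / Λ) θ
  have hSJ : S = (2 * Real.pi)⁻¹ * J.re := by
    have h1 : (S : ℂ) = ((2 * Real.pi : ℝ) : ℂ)⁻¹ * J := by
      rw [hS, hJ]
      congr 1
      refine intervalIntegral.integral_congr fun θ _ => ?_
      simp only [oscPhase, amplitude, vert]
      push_cast
      rfl
    have h2 := congrArg Complex.re h1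
    rwa [← Complex.ofReal_inv, Complex.re_ofReal_mul, Complex.ofReal_re] at h2
  -- Both quantities are `(2π)⁻¹` times the real part of a contour integral.
  have hdiff : |S - ∫ τ in Set.Ioi (0 : ℝ), airyAi (s + τ)| ≤ ‖J - J'‖ := by
    rw [hai, hSJ, ← mul_sub, ← Complex.sub_re, abs_mul, abs_of_pos (by positivity)]
    have h1 : (2 * Real.pi)⁻¹ ≤ 1 := inv_le_one_of_one_le₀ (by linarith [Real.pi_gt_three])
    calc _ ≤ 1 * |(J - J').re| := by gcongr
      _ ≤ _ := by rw [one_mul]; exact Complex.abs_re_le_norm _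
  have hp : 0 < ((2 * Real.pi * ħ) ^ d)⁻¹ := by positivity
  rw [hbulk, ← Complex.ofReal_sub, Complex.norm_real, Real.norm_eq_abs, ← mul_sub, abs_mul,
    abs_of_pos hp]
  refine mul_le_mul_of_nonneg_left ?_ hp.le
  -- Only here does `ε` enter: as `ħ ≤ 1`, lowering the exponent weakens the bound.
  have hpow1 : t ≤ ħ ^ (1 / 3 - ε : ℝ) :=
    Real.rpow_le_rpow_of_exponent_ge hħ hħ1 (by linarith)
  have hpow2 : t ^ 2 ≤ ħ ^ (2 / 3 - ε : ℝ) := by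
    rw [ht2]
    exact Real.rpow_le_rpow_of_exponent_ge hħ hħ1 (by linarith)
  calc _ ≤ C₀ * (1 + 1 / (Λ * a ^ 2)) / Real.sqrt (Λ ^ 2 * a) := hdiff.trans hbound
    _ = C₀ * ((1 + 1 / (Λ * a ^ 2)) / Real.sqrt (Λ ^ 2 * a)) := mul_div_assoc _ _ _
    _ ≤ C₀ * ((1 / (κ * η) + 8 / (κ ^ 2 * η ^ 3)) *
        (t * (1 + |u|) ^ (1 / 2 : ℝ) + |u| ^ (5 / 2 : ℝ) * t ^ 2)) := by gcongr
    _ ≤ C₀ * ((1 / (κ * η) + 8 / (κ ^ 2 * η ^ 3)) *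
        (ħ ^ (1 / 3 - ε : ℝ) * (1 + |u|) ^ (1 / 2 : ℝ) +
          |u| ^ (5 / 2 : ℝ) * ħ ^ (2 / 3 - ε : ℝ))) := by gcongr
    _ = _ := by ring
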